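/- Let $r\ge 1$ be an integer. There exists a constant $C_r>0$ depending only on $r$ such that the following holds. Let $X_1,\dots,X_n$ be i.i.d. random variables on a probability space $(\Omega,\mathcal A,\mathbb P)$ with values in a measurable space $(S,\mathcal S)$ and common law $P$, let $p\ge 1$ be an integer, let $q\ge 1$ be a real number, and let $\psi_1,\dots,\psi_p\in L^{q\vee 2}(P^r)$ be symmetric $\mathcal S^{\otimes r}$-measurable functions $S^r\to\mathbb R$. For a function $f:S^r\to\mathbb R$ that is integrable with respect to $P^r$ and $0\le k\le r$ put \[ (P^{r-k}f)(x_1,\dots,x_k):=\int_{S^{r-k}} f(x_1,\dots,x_k,z_{k+1},\dots,z_r)\,P(dz_{k+1})\cdots P(dz_r) \] (and $0$ where this integral does not exist). Suppose that every $\psi_j$ is degenerate, i.e. $P\psi_j:=P^{1}\psi_j=0$ holds $P^{r-1}$-almost surely. Put \[ J_r(\psi):=\sum_{1\le i_1<\cdots<i_r\le n}\psi(X_{i_1},\dots,X_{i_r}), \] and, for $f:S^s\to\mathbb R$, let $M(f):=\max|f(X_{i_1},\dots,X_{i_s})|$, where the maximum is over all $s$-tuples of pairwise distinct indices $i_1,\dots,i_s\in\{1,\dots,n\}$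 (a maximum over the empty set is $0$; for $s=0$, $f$ is a constant and $M(f)=|f|$). Then \[ \Bigl\|\max_{1\le j\le p}|J_r(\psi_j)|\Bigr\|_{L^q(\mathbb P)} \le C_r\max_{0\le s\le r} n^{\frac{r-s}{2}}(q+\log p)^{\frac{r+s}{2}} \Bigl\|\max_{1\le j\le p}M\bigl(P^{r-s}(\psi_j^2)\bigr)\Bigr\|_{L^{1\vee\frac q2}(\mathbb P)}^{1/2}. \] -/

import Mathlib

open MeasureTheory ProbabilityTheory

open scoped ENNReal

namespace UStat

/-- A kernel of order `r`: an `𝓢^{⊗r}`-measurable function `S^r → ℝ` that is invariant under all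
permutations of its arguments. -/
def IsSymmetricKernel {S : Type*} [MeasurableSpace S] {r : ℕ} (ψ : (Fin r → S) → ℝ) : Prop :=
  Measurable ψ ∧ ∀ (σ : Equiv.Perm (Fin r)) (x : Fin r → S), ψ (fun i => x (σ i)) = ψ x

/-- The function `P^{r-k} ψ : S^k → ℝ`, for `0 ≤ k ≤ r`:
`(P^{r-k} ψ)(x_1, …, x_k) = 𝔼[ψ(x_1, …, x_k, Z_{k+1}, …, Z_r)]`, where `Z_1, …, Z_r` are i.i.d. with
law `P`. At the points `x` where the expectation does not exist (a null set for `ψ ∈ L¹(P^r)`) the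
value is `0`. -/
noncomputable def partialMean {S : Type*} [MeasurableSpace S] (P : Measure S) {r : ℕ} (k : ℕ)
    (ψ : (Fin r → S) → ℝ) (x : Fin k → S) : ℝ :=
  ∫ z : Fin r → S, ψ (fun i => if h : (i : ℕ) < k then x ⟨i, h⟩ else z i)
    ∂(Measure.pi fun _ : Fin r => P)

/-- `ψ` (of order `r ≥ 1`) is degenerate: `P ψ = 0` holds `P^{r-1}`-almost surely. -/
def IsDegenerate {S : Type*} [MeasurableSpace S] (P : Measure S) {r : ℕ}
    (ψ : (Fin r → S) → ℝ) : Prop :=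
  ∀ᵐ x ∂(Measure.pi fun _ : Fin (r - 1) => P), partialMean P (r - 1) ψ x = 0

/-- The U-statistic (not averaged)
`J_r(ψ) = ∑_{1 ≤ i_1 < ⋯ < i_r ≤ n} ψ(X_{i_1}, …, X_{i_r})`. -/
noncomputable def J {Ω S : Type*} {n r : ℕ} (X : Fin n → Ω → S) (ψ : (Fin r → S) → ℝ)
    (ω : Ω) : ℝ :=
  ∑ i : Fin r ↪o Fin n, ψ (fun k => X (i k) ω)

/-- `M(f) = max |f(X_{i_1}, …, X_{i_r})|`, the maximum over all `r`-tuples of pairwise distinct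
indices; the maximum over the empty set is `0`. -/
noncomputable def M {Ω S : Type*} {n r : ℕ} (X : Fin n → Ω → S) (f : (Fin r → S) → ℝ)
    (ω : Ω) : ℝ :=
  ⨆ i : Fin r ↪ Fin n, |f (fun k => X (i k) ω)|

end UStat

/-!
The bound follows from randomisation without decoupling, hypercontractivity, and a self-bounding
argument for nonnegative kernels. By `IsDegenerate.partialMean_ae_eq_zero` nothing changes when
`J_r(ψ)(X)` is replaced by the conditional mean, given `X`, of
`∑_I ∑_{A ⊆ I} (-1)^|A| ψ(X_{I \ A}, X'_A)`, where `X'` is an independent copy of `X` and `I` runs over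
the `r`-element sets of indices: every term with `A ≠ ∅` has conditional mean zero. Exchanging `X_i`
and `X'_i` for `i` in a set `σ` preserves the law of `(X, X')` and multiplies the terms belonging to
`I` by the Walsh function `(-1)^|I ∩ σ|` (`symmetrized_exchange`). Averaged over `σ`, the sum is a
homogeneous Rademacher chaos of order `r` with coefficients fixed by `(X, X')`, and `bonami` bounds
its moments. For a maximum of `p` such chaoses the exponent is raised to about `q + log p`, which
costs a constant factor only (`chaos_moment_le`). This gives the factor `(q + log p)^{r/2}` and leaves
a square function, which is an average over `σ` of the sums `J_r(ψ²)` evaluated at samples that mix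
`X` and `X'` and have the law of `X`. Hence `‖max J_r(ψ)‖_q` is at most a constant times
`(q + log p)^{r/2} ‖max J_r(ψ²)‖_{q/2}^{1/2}` for `q ≥ 2`; smaller `q` are raised to `2`.

It remains to bound `V = ‖max J_r(f)‖_m` for `f = ψ² ≥ 0` and `m = q/2 ≥ 1`. The same conditional
mean is now `J_r(f)` plus terms in `J_s(P^{r-s} f)` with `s < r`, each of size at most `n^{r-s}` times
that statistic. As `J_r(f²) ≤ M(f) J_r(f)`, symmetrisation and the Cauchy–Schwarz inequality yield
`V ≤ c (q + log p)^{r/2} ‖M(f)‖_m^{1/2} V^{1/2} + ∑_{s < r} n^{r-s} ‖max J_s(P^{r-s} f)‖_m`. This can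
be solved for `V` (`eLpNorm_usum_le_add`), and induction on `r` with the tower property
`partialMean_partialMean` completes the bound (`exists_eLpNorm_usum_le`).

The index `j ≤ p` is carried along by working with kernels with values in `Fin p → ℝ`, whose
supremum norm is the maximum over `j`.
-/

namespace UStat

/-! ### Hypercontractivity on the discrete cube -/

theorem sum_range_even_odd (f : ℕ → ℝ) (k : ℕ) :
    ∑ i ∈ Finset.range (2 * k + 1), f i =
      ∑ j ∈ Finset.range (k + 1), f (2 * j) + ∑ j ∈ Finset.range k, f (2 * j + 1) := by
  induction k with
  | zero => simp
  | succ k ih =>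
    rw [show 2 * (k + 1) + 1 = 2 * k + 1 + 1 + 1 by ring, Finset.sum_range_succ,
      Finset.sum_range_succ, ih, Finset.sum_range_succ _ (k + 1), Finset.sum_range_succ _ k,
      Finset.sum_range_succ (fun j => f (2 * j + 1)) k]
    rw [show 2 * (k + 1) = 2 * k + 1 + 1 by ring]
    ring

theorem choose_two_mul_le (k j : ℕ) : (2 * k).choose (2 * j) ≤ (2 * k) ^ j * k.choose j := by
  induction j with
  | zero => simp
  | succ j ih =>
    rcases lt_or_ge j k with hjk | hjk
    · have h1 := Nat.choose_succ_right_eq (2 * k) (2 * j)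
      have h2 := Nat.choose_succ_right_eq (2 * k) (2 * j + 1)
      have h3 := Nat.choose_succ_right_eq k j
      obtain ⟨d, rfl⟩ := Nat.exists_eq_add_of_lt hjk
      set k := j + d + 1 with hk
      have e1 : 2 * k - 2 * j = 2 * (d + 1) := by omega
      have e2 : 2 * k - (2 * j + 1) = 2 * d + 1 := by omega
      have e3 : k - j = d + 1 := by omega
      rw [e1] at h1
      rw [e2] at h2
      rw [e3] at h3
      have hpos : 0 < (2 * j + 1 + 1) * (2 * j + 1) := by positivity
      refine Nat.le_of_mul_le_mul_right ?_ hpos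
      rw [show 2 * (j + 1) = 2 * j + 1 + 1 by ring]
      calc (2 * k).choose (2 * j + 1 + 1) * ((2 * j + 1 + 1) * (2 * j + 1))
          = (2 * k).choose (2 * j) * (2 * (d + 1)) * (2 * d + 1) := by
            rw [← mul_assoc, h2, ← h1]; ring
        _ ≤ (2 * k) ^ j * k.choose j * (2 * (d + 1)) * (2 * k) := by
            gcongr; omega
        _ = (2 * k) ^ (j + 1) * (k.choose j * (d + 1)) * 2 := by ring
        _ = (2 * k) ^ (j + 1) * k.choose (j + 1) * ((2 * j + 1 + 1) * 1) := by rw [← h3]; ring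
        _ ≤ (2 * k) ^ (j + 1) * k.choose (j + 1) * ((2 * j + 1 + 1) * (2 * j + 1)) := by
            gcongr; omega
    · rw [Nat.choose_eq_zero_of_lt (by omega)]; exact Nat.zero_le _

/-- The two-point hypercontractive inequality for even exponents. -/
theorem two_point_ineq (k : ℕ) (u v : ℝ) :
    (u + v) ^ (2 * k) + (u - v) ^ (2 * k) ≤ 2 * (u ^ 2 + (2 * k : ℕ) * v ^ 2) ^ k := by
  have h : (u + v) ^ (2 * k) + (u - v) ^ (2 * k) =
      2 * ∑ j ∈ Finset.range (k + 1), (v ^ 2) ^ j * (u ^ 2) ^ (k - j) * (2 * k).choose (2 * j) := by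
    rw [add_comm u v, sub_eq_neg_add u v, add_pow, add_pow, ← Finset.sum_add_distrib,
      sum_range_even_odd, Finset.mul_sum]
    have h0 : ∑ j ∈ Finset.range k, (v ^ (2 * j + 1) * u ^ (2 * k - (2 * j + 1)) *
        ((2 * k).choose (2 * j + 1) : ℝ) + (-v) ^ (2 * j + 1) * u ^ (2 * k - (2 * j + 1)) *
        ((2 * k).choose (2 * j + 1) : ℝ)) = 0 := by
      refine Finset.sum_eq_zero fun j _ => ?_
      rw [Odd.neg_pow ⟨j, rfl⟩]; ring
    rw [h0, add_zero]
    refine Finset.sum_congr rfl fun j _ => ?_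
    rw [Even.neg_pow (even_two_mul j), ← Nat.mul_sub, pow_mul, pow_mul]
    ring
  rw [h, add_comm (u ^ 2), add_pow]
  refine mul_le_mul_of_nonneg_left (Finset.sum_le_sum fun j _ => ?_) zero_le_two
  rw [mul_pow]
  have hc : ((2 * k).choose (2 * j) : ℝ) ≤ ((2 * k : ℕ) : ℝ) ^ j * k.choose j := by
    exact_mod_cast choose_two_mul_le k j
  calc (v ^ 2) ^ j * (u ^ 2) ^ (k - j) * ((2 * k).choose (2 * j) : ℝ)
      ≤ (v ^ 2) ^ j * (u ^ 2) ^ (k - j) * (((2 * k : ℕ) : ℝ) ^ j * k.choose j) := by gcongr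
    _ = _ := by ring

/-- Minkowski's inequality in `L^k` of a finite set, for natural `k ≥ 1`, freed of roots. -/
theorem sum_add_pow_le {α : Type*} (s : Finset α) (f g : α → ℝ) (hf : ∀ i ∈ s, 0 ≤ f i)
    (hg : ∀ i ∈ s, 0 ≤ g i) {k : ℕ} (hk : 1 ≤ k) {N a b : ℝ} (hN : 0 ≤ N) (ha : 0 ≤ a)
    (hb : 0 ≤ b) (hfa : ∑ i ∈ s, f i ^ k ≤ N * a ^ k) (hgb : ∑ i ∈ s, g i ^ k ≤ N * b ^ k) :
    ∑ i ∈ s, (f i + g i) ^ k ≤ N * (a + b) ^ k := by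
  have hk' : (1 : ℝ) ≤ k := by exact_mod_cast hk
  have hk0 : (k : ℝ) ≠ 0 := by positivity
  have h := Real.Lp_add_le_of_nonneg (p := (k : ℝ)) s hk' hf hg
  simp only [Real.rpow_natCast] at h
  have key : ∀ (S c : ℝ), 0 ≤ S → 0 ≤ c → S ≤ N * c ^ k →
      S ^ (1 / (k : ℝ)) ≤ N ^ (1 / (k : ℝ)) * c := by
    intro S c hS hc h
    calc S ^ (1 / (k : ℝ)) ≤ (N * c ^ k) ^ (1 / (k : ℝ)) := by gcongr
      _ = N ^ (1 / (k : ℝ)) * c := by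
        rw [Real.mul_rpow hN (by positivity), one_div, Real.pow_rpow_inv_natCast hc (by omega)]
  have hfs : 0 ≤ ∑ i ∈ s, f i ^ k := Finset.sum_nonneg fun i hi => pow_nonneg (hf i hi) _
  have hgs : 0 ≤ ∑ i ∈ s, g i ^ k := Finset.sum_nonneg fun i hi => pow_nonneg (hg i hi) _
  have hs : 0 ≤ ∑ i ∈ s, (f i + g i) ^ k :=
    Finset.sum_nonneg fun i hi => pow_nonneg (add_nonneg (hf i hi) (hg i hi)) _
  have h2 : (∑ i ∈ s, (f i + g i) ^ k) ^ (1 / (k : ℝ)) ≤ N ^ (1 / (k : ℝ)) * (a + b) := by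
    rw [mul_add]
    exact h.trans (add_le_add (key _ _ hfs ha hfa) (key _ _ hgs hb hgb))
  calc ∑ i ∈ s, (f i + g i) ^ k
      = ((∑ i ∈ s, (f i + g i) ^ k) ^ (1 / (k : ℝ))) ^ k := by
        rw [one_div, Real.rpow_inv_natCast_pow hs (by omega)]
    _ ≤ (N ^ (1 / (k : ℝ)) * (a + b)) ^ k := by gcongr
    _ = N * (a + b) ^ k := by
        rw [mul_pow, one_div, Real.rpow_inv_natCast_pow hN (by omega)]

/-- Bonami's hypercontractive inequality for even exponents. The point of the cube `{±1}^s` whose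
`-1` coordinates form the set `σ` is represented by `σ ⊆ s`, so that the Walsh function of `A` has
the value `(-1) ^ #(A ∩ σ)` there. -/
theorem bonami {ι : Type*} [DecidableEq ι] {k : ℕ} (hk : 1 ≤ k) (s : Finset ι) :
    ∀ a : Finset ι → ℝ,
    ∑ σ ∈ s.powerset, (∑ A ∈ s.powerset, (-1) ^ (A ∩ σ).card * a A) ^ (2 * k) ≤
      2 ^ s.card * (∑ A ∈ s.powerset, ((2 * k : ℕ) : ℝ) ^ A.card * a A ^ 2) ^ k := by
  induction s using Finset.induction_on with
  | empty => intro a; simp [pow_mul]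
  | insert x s hx ih =>
    intro a
    set g : Finset ι → ℝ := fun σ => ∑ A ∈ s.powerset, (-1) ^ (A ∩ σ).card * a A
    set h : Finset ι → ℝ := fun σ => ∑ A ∈ s.powerset, (-1) ^ (A ∩ σ).card * a (insert x A)
    set G : ℝ := ∑ A ∈ s.powerset, ((2 * k : ℕ) : ℝ) ^ A.card * a A ^ 2
    set H : ℝ := ∑ A ∈ s.powerset, ((2 * k : ℕ) : ℝ) ^ A.card * a (insert x A) ^ 2
    have hG : 0 ≤ G := Finset.sum_nonneg fun _ _ => by positivity
    have hH : 0 ≤ H := Finset.sum_nonneg fun _ _ => by positivity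
    have hgG : ∑ σ ∈ s.powerset, (g σ ^ 2) ^ k ≤ 2 ^ s.card * G ^ k := by
      simpa only [← pow_mul] using ih a
    have hhH : ∑ σ ∈ s.powerset, (h σ ^ 2) ^ k ≤ 2 ^ s.card * H ^ k := by
      simpa only [← pow_mul] using ih (fun A => a (insert x A))
    have hxs : ∀ A ∈ s.powerset, x ∉ A := fun A hA hxA => hx (Finset.mem_powerset.1 hA hxA)
    have e1 : ∀ σ ∈ s.powerset, ∑ A ∈ (insert x s).powerset, (-1) ^ (A ∩ σ).card * a A =
        g σ + h σ := by
      intro σ hσ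
      rw [Finset.sum_powerset_insert hx]
      congr 1
      refine Finset.sum_congr rfl fun A hA => ?_
      rw [Finset.insert_inter_of_notMem (hxs σ hσ)]
    have e2 : ∀ σ ∈ s.powerset,
        ∑ A ∈ (insert x s).powerset, (-1) ^ (A ∩ insert x σ).card * a A = g σ - h σ := by
      intro σ hσ
      rw [Finset.sum_powerset_insert hx, sub_eq_add_neg, ← Finset.sum_neg_distrib]
      congr 1
      · refine Finset.sum_congr rfl fun A hA => ?_
        rw [Finset.inter_insert_of_notMem (hxs A hA)]
      · refine Finset.sum_congr rfl fun A hA => ?_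
        rw [← Finset.insert_inter_distrib, Finset.card_insert_of_notMem
          (fun hh => hxs A hA (Finset.mem_inter.1 hh).1), pow_succ]
        ring
    have e3 : ∑ A ∈ (insert x s).powerset, ((2 * k : ℕ) : ℝ) ^ A.card * a A ^ 2 =
        G + (2 * k : ℕ) * H := by
      rw [Finset.sum_powerset_insert hx, Finset.mul_sum]
      congr 1
      refine Finset.sum_congr rfl fun A hA => ?_
      rw [Finset.card_insert_of_notMem (hxs A hA), pow_succ]
      ring
    rw [e3, Finset.sum_powerset_insert hx, Finset.card_insert_of_notMem hx,
      ← Finset.sum_add_distrib, Finset.sum_congr rfl fun σ hσ => by rw [e1 σ hσ, e2 σ hσ]]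
    calc ∑ σ ∈ s.powerset, ((g σ + h σ) ^ (2 * k) + (g σ - h σ) ^ (2 * k))
        ≤ ∑ σ ∈ s.powerset, 2 * (g σ ^ 2 + (2 * k : ℕ) * h σ ^ 2) ^ k :=
          Finset.sum_le_sum fun σ _ => two_point_ineq k _ _
      _ = 2 * ∑ σ ∈ s.powerset, (g σ ^ 2 + (2 * k : ℕ) * h σ ^ 2) ^ k := by rw [Finset.mul_sum]
      _ ≤ 2 * (2 ^ s.card * (G + (2 * k : ℕ) * H) ^ k) := by
          gcongr
          refine sum_add_pow_le _ _ _ (fun _ _ => by positivity) (fun _ _ => by positivity) hk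
            (by positivity) hG (by positivity) hgG ?_
          simp only [mul_pow _ _ k, ← Finset.mul_sum]
          calc _ ≤ (((2 * k : ℕ) : ℝ)) ^ k * (2 ^ s.card * H ^ k) := by gcongr
            _ = _ := by ring
      _ = _ := by ring

/-- Moment bound for the maximum of `p` homogeneous Rademacher chaoses of order `r`. The union over
the `p` coordinates is absorbed by passing to the even exponent `2 k`, where `k` is about
`(t + log p) / 2`, so that `p ^ (1 / (2 k)) ≤ e`. -/
theorem chaos_moment_le {ι : Type*} [Fintype ι] [DecidableEq ι] {p : ℕ} (hp : 1 ≤ p) {t : ℝ}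
    (ht : 1 ≤ t) (r : ℕ) (a : Finset ι → Fin p → ℝ) {Q : ℝ} (hQ : 0 ≤ Q)
    (ha : ∀ j, ∑ I ∈ Finset.powersetCard r Finset.univ, a I j ^ 2 ≤ Q ^ 2) :
    ∑ σ : Finset ι, ‖∑ I ∈ Finset.powersetCard r Finset.univ, (-1 : ℝ) ^ (I ∩ σ).card • a I‖ ^ t ≤
      2 ^ Fintype.card ι *
        (Real.exp 1 * (3 * (t + Real.log p)) ^ ((r : ℝ) / 2) * Q) ^ t := by
  have hlog : 0 ≤ Real.log p := Real.log_natCast_nonneg p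
  set L := t + Real.log p with hL
  have hL1 : 1 ≤ L := by linarith
  set k := ⌈L / 2⌉₊ with hkdef
  have hkL : L / 2 ≤ k := Nat.le_ceil _
  have hkL' : (k : ℝ) < L / 2 + 1 := Nat.ceil_lt_add_one (by positivity)
  have hk : 1 ≤ k := Nat.one_le_ceil_iff.2 (by positivity)
  have hkR : (1 : ℝ) ≤ k := by exact_mod_cast hk
  have h2k : ((2 * k : ℕ) : ℝ) ≤ 3 * L := by push_cast; linarith
  set Z : Finset ι → Fin p → ℝ :=
    fun σ => ∑ I ∈ Finset.powersetCard r Finset.univ, (-1 : ℝ) ^ (I ∩ σ).card • a I with hZ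
  -- the moment of order `2 k` of each coordinate
  have hj : ∀ j, ∑ σ : Finset ι, Z σ j ^ (2 * k) ≤
      2 ^ Fintype.card ι * ((3 * L) ^ r * Q ^ 2) ^ k := by
    intro j
    have hb := bonami hk (Finset.univ : Finset ι) (fun A => if A.card = r then a A j else 0)
    have e1 : ∀ σ : Finset ι, ∑ A ∈ (Finset.univ : Finset ι).powerset,
        (-1 : ℝ) ^ (A ∩ σ).card * (if A.card = r then a A j else 0) = Z σ j := by
      intro σ
      simp only [hZ, Finset.sum_apply, Pi.smul_apply, smul_eq_mul]
      rw [Finset.powersetCard_eq_filter, Finset.sum_filter]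
      exact Finset.sum_congr rfl fun A _ => by split_ifs <;> simp
    have e2 : ∑ A ∈ (Finset.univ : Finset ι).powerset,
        ((2 * k : ℕ) : ℝ) ^ A.card * (if A.card = r then a A j else 0) ^ 2 =
        ((2 * k : ℕ) : ℝ) ^ r * ∑ I ∈ Finset.powersetCard r Finset.univ, a I j ^ 2 := by
      rw [Finset.powersetCard_eq_filter, Finset.sum_filter, Finset.mul_sum]
      refine Finset.sum_congr rfl fun A _ => ?_
      split_ifs with h
      · rw [h]
      · simp
    rw [e2, Finset.sum_congr rfl fun σ _ => by rw [e1 σ]] at hb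
    simp only [Finset.powerset_univ, Finset.card_univ] at hb
    refine hb.trans ?_
    gcongr
    exact ha j
  set B : ℝ := (3 * L) ^ ((r : ℝ) / 2) * Q with hB
  have hB0 : 0 ≤ B := by positivity
  have hBsq : (3 * L) ^ r * Q ^ 2 = B ^ 2 := by
    rw [hB, mul_pow _ Q 2, ← Real.rpow_natCast (_ ^ _) 2, ← Real.rpow_mul (by positivity)]
    rw [Nat.cast_ofNat, div_mul_cancel₀ _ two_ne_zero, Real.rpow_natCast]
  -- the moment of order `2 k` of the maximum
  have hmax : ∑ σ : Finset ι, ‖Z σ‖ ^ (2 * k) ≤ 2 ^ Fintype.card ι * (p * B ^ (2 * k)) := by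
    calc ∑ σ : Finset ι, ‖Z σ‖ ^ (2 * k) ≤ ∑ σ : Finset ι, ∑ j, Z σ j ^ (2 * k) := by
          refine Finset.sum_le_sum fun σ _ => ?_
          have : Nonempty (Fin p) := ⟨⟨0, hp⟩⟩
          obtain ⟨j, -, hj⟩ := Finset.exists_mem_eq_sup' (Finset.univ_nonempty (α := Fin p))
            (fun j => ‖Z σ j‖)
          have : ‖Z σ‖ ≤ ‖Z σ j‖ := by
            rw [pi_norm_le_iff_of_nonneg (norm_nonneg _), ← hj]
            exact fun i => Finset.le_sup' (fun j => ‖Z σ j‖) (Finset.mem_univ i)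
          calc ‖Z σ‖ ^ (2 * k) ≤ ‖Z σ j‖ ^ (2 * k) := by gcongr
            _ = Z σ j ^ (2 * k) := by rw [Real.norm_eq_abs, Even.pow_abs (even_two_mul k)]
            _ ≤ _ := Finset.single_le_sum (f := fun j => Z σ j ^ (2 * k))
                (fun i _ => Even.pow_nonneg (even_two_mul k) _) (Finset.mem_univ j)
      _ = ∑ j, ∑ σ : Finset ι, Z σ j ^ (2 * k) := Finset.sum_comm
      _ ≤ ∑ j : Fin p, 2 ^ Fintype.card ι * ((3 * L) ^ r * Q ^ 2) ^ k :=
          Finset.sum_le_sum fun j _ => hj j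
      _ = _ := by rw [hBsq, ← pow_mul]; simp; ring
  have ht0 : 0 < t := by linarith
  have ht2k : t ≤ ((2 * k : ℕ) : ℝ) := by push_cast; linarith
  have hu : 1 ≤ ((2 * k : ℕ) : ℝ) / t := by rwa [le_div_iff₀ ht0, one_mul]
  set N : ℝ := 2 ^ Fintype.card ι with hN
  have hN0 : 0 < N := by positivity
  have hcard : ∑ _σ : Finset ι, N⁻¹ = 1 := by
    simp [hN]
  -- Jensen's inequality from the exponent `2 k` down to `t`
  have hjen := Real.rpow_arith_mean_le_arith_mean_rpow (Finset.univ : Finset (Finset ι))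
    (fun _ => N⁻¹) (fun σ => ‖Z σ‖ ^ t) (fun _ _ => by positivity) hcard
    (fun _ _ => by positivity) hu
  simp only [← Real.rpow_mul (norm_nonneg _), mul_div_cancel₀ _ ht0.ne', Real.rpow_natCast,
    ← Finset.mul_sum] at hjen
  have h3 : (N⁻¹ * ∑ σ : Finset ι, ‖Z σ‖ ^ t) ^ (((2 * k : ℕ) : ℝ) / t) ≤ p * B ^ (2 * k) := by
    refine hjen.trans ?_
    rw [inv_mul_le_iff₀ hN0]
    exact hmax
  have h2k0 : (0 : ℝ) < (2 * k : ℕ) := by positivity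
  have hp0 : (0 : ℝ) < p := by exact_mod_cast hp
  have hpe : (p : ℝ) ≤ Real.exp 1 ^ (2 * k) := by
    rw [← Real.exp_nat_mul, mul_one]
    calc (p : ℝ) = Real.exp (Real.log p) := (Real.exp_log hp0).symm
      _ ≤ _ := by gcongr; push_cast; linarith
  have h4 : N⁻¹ * ∑ σ : Finset ι, ‖Z σ‖ ^ t ≤ (Real.exp 1 * B) ^ t := by
    have hx : 0 ≤ N⁻¹ * ∑ σ : Finset ι, ‖Z σ‖ ^ t := by positivity
    refine le_of_not_gt fun hlt => ?_
    have hlt' := Real.rpow_lt_rpow (by positivity) hlt (show 0 < ((2 * k : ℕ) : ℝ) / t by positivity)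
    rw [← Real.rpow_mul (by positivity), mul_div_cancel₀ _ ht0.ne', Real.rpow_natCast,
      mul_pow] at hlt'
    have : p * B ^ (2 * k) ≤ Real.exp 1 ^ (2 * k) * B ^ (2 * k) := by gcongr
    linarith
  rw [inv_mul_le_iff₀ hN0] at h4
  rwa [hB, ← mul_assoc] at h4

/-! ### Sums over subsets and their intersections -/

section Finite

variable {ι : Type*} [DecidableEq ι]

theorem neg_one_pow_card_symmDiff (A T : Finset ι) :
    (-1 : ℝ) ^ (symmDiff A T).card = (-1) ^ A.card * (-1) ^ T.card := by
  have h1 : (symmDiff A T).card = (A \ T).card + (T \ A).card :=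
    Finset.card_union_of_disjoint disjoint_sdiff_sdiff
  rw [h1, ← Finset.card_sdiff_add_card_inter A T, ← Finset.card_sdiff_add_card_inter T A,
    Finset.inter_comm T A, pow_add, pow_add, pow_add]
  have h2 : (-1 : ℝ) ^ (A ∩ T).card * (-1) ^ (A ∩ T).card = 1 := by
    rw [← mul_pow]; simp
  linear_combination -((-1 : ℝ) ^ (A \ T).card * (-1) ^ (T \ A).card) * h2

/-- Summing a function of `I ∩ σ` over all `σ` counts every subset of `I` equally often. -/
theorem two_pow_smul_sum_inter [Fintype ι] {E : Type*} [AddCommGroup E] [Module ℝ E]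
    (I : Finset ι) (h : Finset ι → E) :
    (2 : ℝ) ^ I.card • ∑ σ : Finset ι, h (I ∩ σ) =
      (2 : ℝ) ^ Fintype.card ι • ∑ A ∈ I.powerset, h A := by
  rw [← Finset.sum_fiberwise_of_maps_to (s := Finset.univ) (t := I.powerset)
    (g := fun σ => I ∩ σ) (fun σ _ => by simp), Finset.smul_sum, Finset.smul_sum]
  refine Finset.sum_congr rfl fun A hA => ?_
  have hAI := Finset.mem_powerset.1 hA
  have hf : (Finset.univ.filter fun σ : Finset ι => I ∩ σ = A) = Finset.Icc A (A ∪ Iᶜ) := by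
    ext σ
    simp only [Finset.mem_filter, Finset.mem_univ, true_and, Finset.mem_Icc]
    constructor
    · rintro rfl
      refine ⟨Finset.inter_subset_right, fun x hx => ?_⟩
      by_cases hxI : x ∈ I <;> simp [hx, hxI]
    · rintro ⟨h1, h2⟩
      ext x
      constructor
      · intro hx
        have h3 := h2 (Finset.mem_inter.1 hx).2
        have h4 := (Finset.mem_inter.1 hx).1
        simpa [h4] using h3
      · intro hx
        exact Finset.mem_inter.2 ⟨hAI hx, h1 hx⟩
  have hcard : (Finset.Icc A (A ∪ Iᶜ)).card = 2 ^ Iᶜ.card := by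
    rw [Finset.card_Icc_finset Finset.subset_union_left, Finset.card_union_of_disjoint]
    · congr 1; omega
    · exact Finset.disjoint_of_subset_left hAI disjoint_compl_right
  rw [Finset.sum_congr rfl (g := fun _ => h A) (fun σ hσ => by rw [(Finset.mem_filter.1 hσ).2]),
    Finset.sum_const, hf, hcard, ← Nat.cast_smul_eq_nsmul ℝ, smul_smul]
  push_cast
  rw [← pow_add, Finset.card_add_card_compl]

end Finite

/-! ### Exchanging coordinates between two samples -/

section Mix

variable {ι S : Type*} [DecidableEq ι]

/-- The sample that has the coordinates of `w.2` on `A` and those of `w.1` off `A`. -/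
def mix (A : Finset ι) (w : (ι → S) × (ι → S)) : ι → S := fun i => if i ∈ A then w.2 i else w.1 i

/-- The pair of samples obtained from `w` by exchanging the coordinates with index in `σ`. -/
def exchange (σ : Finset ι) (w : (ι → S) × (ι → S)) : (ι → S) × (ι → S) := (mix σ w, mix σ w.swap)

theorem mix_exchange (A σ : Finset ι) (w : (ι → S) × (ι → S)) :
    mix A (exchange σ w) = mix (symmDiff A σ) w := by
  funext i
  by_cases h1 : i ∈ A <;> by_cases h2 : i ∈ σ <;> simp [mix, exchange, h1, h2, Finset.mem_symmDiff]

theorem apply_mix_inter {E : Type*} {f : (ι → S) → E} {I : Finset ι} (hf : DependsOn f I)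
    (A : Finset ι) (w : (ι → S) × (ι → S)) : f (mix (I ∩ A) w) = f (mix A w) := by
  refine hf fun i hi => ?_
  have hi' : i ∈ I := hi
  simp [mix, hi']

theorem measurable_mix [MeasurableSpace S] (A : Finset ι) : Measurable (mix A : (ι → S) × (ι → S) → ι → S) := by
  refine measurable_pi_lambda _ fun i => ?_
  by_cases h : i ∈ A
  · simp only [mix, h, if_true]; fun_prop
  · simp only [mix, h, if_false]; fun_prop

variable [Fintype ι]

/-- The symmetrised sum `∑_I ∑_{A ⊆ I} (-1)^|A| F_I(x^A)`, over the sets `I` of size `r`, of kernels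
`F_I`; here `x^A` is `x` with the coordinates in `A` replaced by those of the second sample. -/
def symmetrized {E : Type*} [AddCommGroup E] [Module ℝ E] (r : ℕ) (F : Finset ι → (ι → S) → E)
    (w : (ι → S) × (ι → S)) : E :=
  ∑ I ∈ Finset.powersetCard r Finset.univ, ∑ A ∈ I.powerset, (-1 : ℝ) ^ A.card • F I (mix A w)

/-- Exchanging coordinates turns the symmetrised sum into a Rademacher chaos. -/
theorem symmetrized_exchange {E : Type*} [AddCommGroup E] [Module ℝ E] (r : ℕ)
    (F : Finset ι → (ι → S) → E) (hF : ∀ I, DependsOn (F I) I) (σ : Finset ι)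
    (w : (ι → S) × (ι → S)) :
    symmetrized r F (exchange σ w) =
      ∑ I ∈ Finset.powersetCard r Finset.univ,
        (-1 : ℝ) ^ (I ∩ σ).card • ∑ A ∈ I.powerset, (-1 : ℝ) ^ A.card • F I (mix A w) := by
  refine Finset.sum_congr rfl fun I _ => ?_
  rw [Finset.smul_sum]
  have hmem : ∀ A ∈ I.powerset, symmDiff A (I ∩ σ) ∈ I.powerset := fun A hA =>
    Finset.mem_powerset.2 fun x hx => by
      rcases Finset.mem_symmDiff.1 hx with h | h
      · exact Finset.mem_powerset.1 hA h.1
      · exact (Finset.mem_inter.1 h.1).1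
  refine Finset.sum_nbij' (fun A => symmDiff A (I ∩ σ)) (fun A => symmDiff A (I ∩ σ)) hmem hmem
    (fun A _ => symmDiff_symmDiff_cancel_right _ _)
    (fun A _ => symmDiff_symmDiff_cancel_right _ _) fun A hA => ?_
  rw [smul_smul, neg_one_pow_card_symmDiff, mix_exchange]
  congr 1
  · rw [mul_left_comm, ← mul_pow]; simp
  · rw [← apply_mix_inter (hF I) (symmDiff A σ), ← apply_mix_inter (hF I) (symmDiff A (I ∩ σ))]
    congr 2
    ext x
    simp only [Finset.mem_inter, Finset.mem_symmDiff]
    tauto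

variable [MeasurableSpace S] (P : Measure S) [IsProbabilityMeasure P]

theorem measurePreserving_exchange (σ : Finset ι) :
    MeasurePreserving (exchange σ)
      ((Measure.pi fun _ : ι => P).prod (Measure.pi fun _ : ι => P))
      ((Measure.pi fun _ : ι => P).prod (Measure.pi fun _ : ι => P)) := by
  have he := measurePreserving_arrowProdEquivProdArrow S S ι (fun _ => P) (fun _ => P)
  have hs : MeasurePreserving (fun (z : ι → S × S) i => (if i ∈ σ then Prod.swap else id) (z i))
      (Measure.pi fun _ => P.prod P) (Measure.pi fun _ => P.prod P) := by
    refine measurePreserving_pi (f := fun i => if i ∈ σ then Prod.swap else id) _ _ fun i => ?_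
    by_cases h : i ∈ σ
    · simp only [h, if_true]; exact Measure.measurePreserving_swap
    · simp only [h, if_false]; exact MeasurePreserving.id _
  have h := (he.comp hs).comp he.symm
  convert h using 1
  funext w
  refine Prod.ext ?_ ?_ <;> funext i <;> by_cases hi : i ∈ σ <;>
    simp [exchange, mix, hi, MeasurableEquiv.arrowProdEquivProdArrow, MeasurableEquiv.symm,
      Equiv.arrowProdEquivProdArrow]

theorem measurePreserving_mix (A : Finset ι) :
    MeasurePreserving (mix A)
      ((Measure.pi fun _ : ι => P).prod (Measure.pi fun _ : ι => P)) (Measure.pi fun _ : ι => P) :=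
  measurePreserving_fst.comp (measurePreserving_exchange P A)

end Mix

/-! ### Norm bounds for symmetrised sums -/

section Norms

theorem eLpNorm_ofReal {α E : Type*} [MeasurableSpace α] [NormedAddCommGroup E] (f : α → E)
    (μ : Measure α) {t : ℝ} (ht : 1 ≤ t) :
    eLpNorm f (ENNReal.ofReal t) μ = (∫⁻ x, ‖f x‖ₑ ^ t ∂μ) ^ (1 / t) := by
  rw [eLpNorm_eq_lintegral_rpow_enorm_toReal (by simp; linarith) ENNReal.ofReal_ne_top,
    ENNReal.toReal_ofReal (by linarith)]

/-- Integrating out one of two independent variables does not increase `L^t` norms. -/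
theorem eLpNorm_le_of_enorm_le_lintegral {α β E E' : Type*} [MeasurableSpace α]
    [MeasurableSpace β] [NormedAddCommGroup E] [NormedAddCommGroup E'] [MeasurableSpace E]
    [OpensMeasurableSpace E] [SecondCountableTopology E] {μ : Measure α} {ν : Measure β}
    [SFinite μ] [IsProbabilityMeasure ν]
    {F : α × β → E} (hF : Measurable F) {R : α → E'} {t : ℝ} (ht : 1 ≤ t)
    (h : ∀ᵐ x ∂μ, ‖R x‖ₑ ≤ ∫⁻ z, ‖F (x, z)‖ₑ ∂ν) :
    eLpNorm R (ENNReal.ofReal t) μ ≤ eLpNorm F (ENNReal.ofReal t) (μ.prod ν) := by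
  have ht0 : 0 < t := by linarith
  rw [eLpNorm_ofReal _ _ ht, eLpNorm_ofReal _ _ ht]
  refine ENNReal.rpow_le_rpow ?_ (by positivity)
  rw [lintegral_prod _ (by fun_prop)]
  refine lintegral_mono_ae (h.mono fun x hx => ?_)
  have h1 : ∫⁻ z, ‖F (x, z)‖ₑ ∂ν ≤ (∫⁻ z, ‖F (x, z)‖ₑ ^ t ∂ν) ^ (1 / t) := by
    have hm : AEStronglyMeasurable (fun z => F (x, z)) ν :=
      (hF.comp measurable_prodMk_left).aestronglyMeasurable
    have := eLpNorm_le_eLpNorm_of_exponent_le (p := 1) (q := ENNReal.ofReal t)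
      (by simpa using ht) hm
    rwa [eLpNorm_one_eq_lintegral_enorm, eLpNorm_ofReal _ _ ht] at this
  calc ‖R x‖ₑ ^ t ≤ ((∫⁻ z, ‖F (x, z)‖ₑ ^ t ∂ν) ^ (1 / t)) ^ t :=
        ENNReal.rpow_le_rpow (hx.trans h1) ht0.le
    _ = _ := by rw [← ENNReal.rpow_mul, one_div_mul_cancel ht0.ne', ENNReal.rpow_one]

/-- The Cauchy–Schwarz inequality `‖√(f g)‖_t ≤ (‖f‖_t ‖g‖_t)^{1/2}`. -/
theorem eLpNorm_sqrt_mul_le {α : Type*} [MeasurableSpace α] {μ : Measure α} {f g : α → ℝ}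
    (hf : Measurable f) (hg : Measurable g) {t : ℝ} (ht : 1 ≤ t) :
    eLpNorm (fun x => √(f x * g x)) (ENNReal.ofReal t) μ ≤
      (eLpNorm f (ENNReal.ofReal t) μ * eLpNorm g (ENNReal.ofReal t) μ) ^ (1 / 2 : ℝ) := by
  have ht0 : 0 < t := by linarith
  rw [eLpNorm_ofReal _ _ ht, eLpNorm_ofReal _ _ ht, eLpNorm_ofReal _ _ ht,
    ← ENNReal.mul_rpow_of_nonneg _ _ (by positivity), ← ENNReal.rpow_mul, mul_comm (1 / t) (1 / 2),
    ENNReal.rpow_mul]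
  refine ENNReal.rpow_le_rpow ?_ (by positivity)
  have hpt : ∀ x, ‖√(f x * g x)‖ₑ ^ t ≤ ‖f x‖ₑ ^ (t / 2) * ‖g x‖ₑ ^ (t / 2) := by
    intro x
    rw [← ENNReal.mul_rpow_of_nonneg _ _ (by positivity), ← enorm_mul]
    have : ‖√(f x * g x)‖ₑ ^ (2 : ℝ) ≤ ‖f x * g x‖ₑ := by
      rw [Real.enorm_eq_ofReal_abs, Real.enorm_eq_ofReal_abs,
        ENNReal.ofReal_rpow_of_nonneg (abs_nonneg _) (by norm_num)]
      refine ENNReal.ofReal_le_ofReal ?_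
      rw [Real.rpow_two, sq_abs]
      rcases le_total 0 (f x * g x) with h | h
      · rw [Real.sq_sqrt h]; exact le_abs_self _
      · rw [Real.sqrt_eq_zero_of_nonpos h]; simpa using abs_nonneg (f x * g x)
    calc ‖√(f x * g x)‖ₑ ^ t = (‖√(f x * g x)‖ₑ ^ (2 : ℝ)) ^ (t / 2) := by
          rw [← ENNReal.rpow_mul]; congr 1; ring
      _ ≤ _ := ENNReal.rpow_le_rpow this (by positivity)
  have hh := ENNReal.lintegral_mul_le_Lp_mul_Lq μ Real.HolderConjugate.two_two
    (f := fun x => ‖f x‖ₑ ^ (t / 2)) (g := fun x => ‖g x‖ₑ ^ (t / 2))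
    (by fun_prop) (by fun_prop)
  simp only [Pi.mul_apply, ← ENNReal.rpow_mul, div_mul_cancel₀ t two_ne_zero] at hh
  rw [ENNReal.mul_rpow_of_nonneg _ _ (by positivity)]
  exact (lintegral_mono hpt).trans hh

variable {ι S : Type*} [Fintype ι] [DecidableEq ι] [MeasurableSpace S]
  (P : Measure S) [IsProbabilityMeasure P]

/-- A bound on the average of `D` over all exchanges of coordinates bounds the norm of `D`. -/
theorem eLpNorm_le_of_sum_exchange_le {E : Type*} [NormedAddCommGroup E] [MeasurableSpace E]
    [OpensMeasurableSpace E] {D : (ι → S) × (ι → S) → E} (hD : Measurable D)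
    {Q : (ι → S) × (ι → S) → ℝ} {t : ℝ} (ht : 1 ≤ t) (hQ : ∀ w, 0 ≤ Q w)
    (h : ∀ w, ∑ σ : Finset ι, ‖D (exchange σ w)‖ ^ t ≤ 2 ^ Fintype.card ι * Q w ^ t) :
    eLpNorm D (ENNReal.ofReal t) ((Measure.pi fun _ : ι => P).prod (Measure.pi fun _ : ι => P)) ≤
      eLpNorm Q (ENNReal.ofReal t)
        ((Measure.pi fun _ : ι => P).prod (Measure.pi fun _ : ι => P)) := by
  have ht0 : 0 < t := by linarith
  rw [eLpNorm_ofReal _ _ ht, eLpNorm_ofReal _ _ ht]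
  refine ENNReal.rpow_le_rpow ?_ (by positivity)
  set W := (Measure.pi fun _ : ι => P).prod (Measure.pi fun _ : ι => P)
  have hN0 : (2 : ℝ≥0∞) ^ Fintype.card ι ≠ 0 := by simp
  have hNt : (2 : ℝ≥0∞) ^ Fintype.card ι ≠ ∞ := by simp
  refine (ENNReal.mul_le_mul_iff_right hN0 hNt).1 ?_
  calc (2 : ℝ≥0∞) ^ Fintype.card ι * ∫⁻ w, ‖D w‖ₑ ^ t ∂W
      = ∑ σ : Finset ι, ∫⁻ w, ‖D (exchange σ w)‖ₑ ^ t ∂W := by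
        rw [Finset.sum_congr rfl fun σ _ => (measurePreserving_exchange P σ).lintegral_comp
          (f := fun w => ‖D w‖ₑ ^ t) (by fun_prop)]
        simp [W]
    _ = ∫⁻ w, ∑ σ : Finset ι, ‖D (exchange σ w)‖ₑ ^ t ∂W := by
        rw [lintegral_finsetSum]
        intro σ _
        have := (measurePreserving_exchange P σ).measurable
        fun_prop
    _ ≤ ∫⁻ w, (2 : ℝ≥0∞) ^ Fintype.card ι * ‖Q w‖ₑ ^ t ∂W := by
        refine lintegral_mono fun w => ?_
        have := ENNReal.ofReal_le_ofReal (h w)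
        rw [ENNReal.ofReal_sum_of_nonneg (fun _ _ => by positivity),
          ENNReal.ofReal_mul (by positivity), ENNReal.ofReal_pow (by norm_num),
          ENNReal.ofReal_ofNat, ← ENNReal.ofReal_rpow_of_nonneg (hQ w) ht0.le] at this
        rw [Real.enorm_of_nonneg (hQ w)]
        refine le_trans (le_of_eq (Finset.sum_congr rfl fun σ _ => ?_)) this
        rw [← ofReal_norm, ENNReal.ofReal_rpow_of_nonneg (norm_nonneg _) ht0.le]
    _ = _ := lintegral_const_mul' _ _ hNt

/-- The triangle inequality for averages over the `2^n` samples `mix σ w`, each of which has the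
law of the original sample. -/
theorem eLpNorm_le_of_le_sum_mix {E E' : Type*} [NormedAddCommGroup E] [NormedAddCommGroup E']
    {a : (ι → S) × (ι → S) → E} {b : (ι → S) → E'}
    (hb : AEStronglyMeasurable b (Measure.pi fun _ : ι => P)) {m : ℝ≥0∞} (hm : 1 ≤ m) (r : ℕ)
    (h : ∀ w, 2 ^ Fintype.card ι * ‖a w‖ ≤ 2 ^ r * ∑ σ : Finset ι, ‖b (mix σ w)‖) :
    eLpNorm a m ((Measure.pi fun _ : ι => P).prod (Measure.pi fun _ : ι => P)) ≤
      2 ^ r * eLpNorm b m (Measure.pi fun _ : ι => P) := by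
  set W := (Measure.pi fun _ : ι => P).prod (Measure.pi fun _ : ι => P)
  set N : ℝ := 2 ^ Fintype.card ι with hN
  have hN0 : 0 < N := by positivity
  have h1 : eLpNorm a m W ≤ ENNReal.ofReal (2 ^ r * N⁻¹) *
      eLpNorm (∑ σ : Finset ι, fun w => ‖b (mix σ w)‖) m W := by
    refine eLpNorm_le_mul_eLpNorm_of_ae_le_mul (Filter.Eventually.of_forall fun w => ?_) _
    rw [Finset.sum_apply, Real.norm_of_nonneg (Finset.sum_nonneg fun _ _ => norm_nonneg _),
      mul_right_comm, ← div_eq_mul_inv, le_div_iff₀ hN0, mul_comm ‖a w‖]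
    exact h w
  have h2 : eLpNorm (∑ σ : Finset ι, fun w => ‖b (mix σ w)‖) m W ≤
      ∑ σ : Finset ι, eLpNorm b m (Measure.pi fun _ : ι => P) := by
    refine (eLpNorm_sum_le (fun σ _ =>
      (hb.comp_measurePreserving (measurePreserving_mix P σ)).norm) hm).trans ?_
    refine Finset.sum_le_sum fun σ _ => ?_
    rw [eLpNorm_norm (b ∘ mix σ)]
    exact (eLpNorm_comp_measurePreserving hb (measurePreserving_mix P σ)).le
  refine (h1.trans (mul_le_mul_right h2 _)).trans (le_of_eq ?_)
  rw [Finset.sum_const, Finset.card_univ, Fintype.card_finset, nsmul_eq_mul, ← mul_assoc,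
    ENNReal.ofReal_mul (by positivity), ENNReal.ofReal_inv_of_pos hN0, hN,
    ENNReal.ofReal_pow (by norm_num), ENNReal.ofReal_pow (by norm_num), ENNReal.ofReal_ofNat]
  push_cast
  rw [mul_assoc ((2 : ℝ≥0∞) ^ r), ENNReal.inv_mul_cancel (by simp) (by simp), mul_one]

/-- The norm of a sum over all `I` and all ways of distributing `I` over two independent samples is
at most `2^r` times that of the sum over one sample. -/
theorem eLpNorm_sum_mix_le {E : Type*} [NormedAddCommGroup E] [NormedSpace ℝ E]
    [MeasurableSpace E] [BorelSpace E] [SecondCountableTopology E] (r : ℕ)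
    {G : Finset ι → (ι → S) → E} (hG : ∀ I, DependsOn (G I) I) (hGm : ∀ I, Measurable (G I))
    {m : ℝ≥0∞} (hm : 1 ≤ m) :
    eLpNorm (fun w => ∑ I ∈ Finset.powersetCard r Finset.univ, ∑ A ∈ I.powerset, G I (mix A w)) m
        ((Measure.pi fun _ : ι => P).prod (Measure.pi fun _ : ι => P)) ≤
      2 ^ r * eLpNorm (fun x => ∑ I ∈ Finset.powersetCard r Finset.univ, G I x) m
        (Measure.pi fun _ : ι => P) := by
  have hm2 : Measurable fun x => ∑ I ∈ Finset.powersetCard r Finset.univ, G I x :=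
    Finset.measurable_sum _ fun I _ => hGm I
  refine eLpNorm_le_of_le_sum_mix P hm2.aestronglyMeasurable hm r fun w => ?_
  have e : (2 : ℝ) ^ Fintype.card ι •
      ∑ I ∈ Finset.powersetCard r Finset.univ, ∑ A ∈ I.powerset, G I (mix A w) =
      (2 : ℝ) ^ r • ∑ σ : Finset ι, ∑ I ∈ Finset.powersetCard r Finset.univ, G I (mix σ w) := by
    rw [Finset.sum_comm, Finset.smul_sum, Finset.smul_sum]
    refine Finset.sum_congr rfl fun I hI => ?_
    rw [← two_pow_smul_sum_inter I (fun A => G I (mix A w)), (Finset.mem_powersetCard.1 hI).2]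
    simp only [apply_mix_inter (hG I)]
  calc 2 ^ Fintype.card ι *
        ‖∑ I ∈ Finset.powersetCard r Finset.univ, ∑ A ∈ I.powerset, G I (mix A w)‖
      = 2 ^ r * ‖∑ σ : Finset ι, ∑ I ∈ Finset.powersetCard r Finset.univ, G I (mix σ w)‖ := by
        have := congrArg norm e
        rwa [norm_smul, norm_smul, Real.norm_of_nonneg (by positivity),
          Real.norm_of_nonneg (by positivity)] at this
    _ ≤ _ := by gcongr; exact norm_sum_le _ _

/-- The largest kernel value over all ways of distributing the arguments over two independent
samples is controlled by a bound `b` for the kernel values on one sample: a fixed pair `(I, A)`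
occurs as `(I, I ∩ σ)` for a fraction `2^{-r}` of all `σ`. -/
theorem eLpNorm_sup_mix_le {E E' : Type*} [NormedAddCommGroup E] [NormedAddCommGroup E']
    (r : ℕ) {G : Finset ι → (ι → S) → E} (hG : ∀ I, DependsOn (G I) I)
    {b : (ι → S) → E'} (hb : AEStronglyMeasurable b (Measure.pi fun _ : ι => P))
    (hGb : ∀ I ∈ Finset.powersetCard r Finset.univ, ∀ x, ‖G I x‖ ≤ ‖b x‖)
    {m : ℝ≥0∞} (hm : 1 ≤ m) :
    eLpNorm (fun w => fun IA : Finset ι × Finset ι =>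
        if IA.1 ∈ Finset.powersetCard r Finset.univ ∧ IA.2 ⊆ IA.1 then ‖G IA.1 (mix IA.2 w)‖ else 0) m
        ((Measure.pi fun _ : ι => P).prod (Measure.pi fun _ : ι => P)) ≤
      2 ^ r * eLpNorm b m (Measure.pi fun _ : ι => P) := by
  refine eLpNorm_le_of_le_sum_mix P hb hm r fun w => ?_
  have hN : (0 : ℝ) < 2 ^ Fintype.card ι := by positivity
  rw [mul_comm, ← le_div_iff₀ hN, pi_norm_le_iff_of_nonneg (by positivity)]
  rintro ⟨I, A⟩
  dsimp only
  split_ifs with hIA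
  · obtain ⟨hI, hA⟩ := hIA
    rw [le_div_iff₀ hN, norm_norm, mul_comm]
    calc 2 ^ Fintype.card ι * ‖G I (mix A w)‖
        ≤ 2 ^ Fintype.card ι * ∑ B ∈ I.powerset, ‖G I (mix B w)‖ := by
          gcongr
          exact Finset.single_le_sum (f := fun B => ‖G I (mix B w)‖) (fun _ _ => norm_nonneg _)
            (Finset.mem_powerset.2 hA)
      _ = 2 ^ r * ∑ σ : Finset ι, ‖G I (mix σ w)‖ := by
          rw [← smul_eq_mul, ← two_pow_smul_sum_inter I (fun B => ‖G I (mix B w)‖), (Finset.mem_powersetCard.1 hI).2]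
          simp only [apply_mix_inter (hG I), smul_eq_mul]
      _ ≤ _ := by
          gcongr with σ _
          exact hGb I hI _
  · simp only [norm_zero]; positivity

/-- Symmetrisation: the `L^t` norm of the symmetrised sum is bounded by that of the square function,
at the price of the factor `(t + log p)^{r/2}` of a Rademacher chaos. -/
theorem eLpNorm_symmetrized_le {p : ℕ} (hp : 1 ≤ p) {t : ℝ} (ht : 1 ≤ t) (r : ℕ)
    {F : Finset ι → (ι → S) → Fin p → ℝ} (hF : ∀ I, DependsOn (F I) I)
    (hFm : ∀ I, Measurable (F I)) :
    eLpNorm (symmetrized r F) (ENNReal.ofReal t)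
        ((Measure.pi fun _ : ι => P).prod (Measure.pi fun _ : ι => P)) ≤
      ENNReal.ofReal (Real.exp 1 * 6 ^ ((r : ℝ) / 2) * (t + Real.log p) ^ ((r : ℝ) / 2)) *
        eLpNorm (fun w => √‖∑ I ∈ Finset.powersetCard r Finset.univ,
          ∑ A ∈ I.powerset, F I (mix A w) ^ 2‖) (ENNReal.ofReal t)
          ((Measure.pi fun _ : ι => P).prod (Measure.pi fun _ : ι => P)) := by
  have hlog : 0 ≤ Real.log p := Real.log_natCast_nonneg p
  have hDm : Measurable (symmetrized r F) := by
    refine Finset.measurable_sum _ fun I _ => Finset.measurable_sum _ fun A _ => ?_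
    exact ((hFm I).comp (measurable_mix A)).const_smul ((-1 : ℝ) ^ A.card)
  set V : (ι → S) × (ι → S) → Fin p → ℝ := fun w => ∑ I ∈ Finset.powersetCard r Finset.univ,
    ∑ A ∈ I.powerset, F I (mix A w) ^ 2 with hV
  set c : ℝ := Real.exp 1 * 6 ^ ((r : ℝ) / 2) * (t + Real.log p) ^ ((r : ℝ) / 2) with hc
  have hc0 : 0 ≤ c := by positivity
  refine (eLpNorm_le_of_sum_exchange_le P hDm (Q := fun w => c * √‖V w‖) ht
    (fun w => by positivity) fun w => ?_).trans ?_
  · set a : Finset ι → Fin p → ℝ := fun I => ∑ A ∈ I.powerset, (-1 : ℝ) ^ A.card • F I (mix A w)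
    have hcQ : c * √‖V w‖ =
        Real.exp 1 * (3 * (t + Real.log p)) ^ ((r : ℝ) / 2) * √(2 ^ r * ‖V w‖) := by
      rw [hc, Real.sqrt_mul (by positivity), Real.sqrt_eq_rpow (2 ^ r), ← Real.rpow_natCast 2 r,
        ← Real.rpow_mul zero_le_two, show (6 : ℝ) = 3 * 2 by norm_num,
        Real.mul_rpow (by norm_num) (by norm_num), Real.mul_rpow (by norm_num) (by positivity),
        show (r : ℝ) * (1 / 2) = r / 2 by ring]
      ring
    simp only [symmetrized_exchange r F hF]
    rw [hcQ]
    refine chaos_moment_le hp ht r a (Real.sqrt_nonneg _) fun j => ?_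
    rw [Real.sq_sqrt (by positivity)]
    calc ∑ I ∈ Finset.powersetCard r Finset.univ, a I j ^ 2
        ≤ ∑ I ∈ Finset.powersetCard r Finset.univ,
            2 ^ r * ∑ A ∈ I.powerset, F I (mix A w) j ^ 2 := by
          refine Finset.sum_le_sum fun I hI => ?_
          have h := sq_sum_le_card_mul_sum_sq (s := I.powerset)
            (f := fun A => (-1 : ℝ) ^ A.card * F I (mix A w) j)
          rw [Finset.card_powerset, (Finset.mem_powersetCard.1 hI).2] at h
          simp only [mul_pow, ← pow_mul, mul_comm _ 2, even_two_mul, Even.neg_one_pow,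
            one_mul] at h
          simpa [a] using h
      _ = 2 ^ r * V w j := by simp [hV, Finset.mul_sum, Finset.sum_apply]
      _ ≤ 2 ^ r * ‖V w‖ := by
          gcongr
          exact (le_abs_self _).trans (norm_le_pi_norm (V w) j)
  · refine eLpNorm_le_mul_eLpNorm_of_ae_le_mul (Filter.Eventually.of_forall fun w => ?_) _
    rw [Real.norm_of_nonneg (by positivity), Real.norm_of_nonneg (by positivity)]

/-- Symmetrisation of nonnegative kernels: the square function is bounded by the geometric mean of
the largest kernel value and of the sum itself. -/
theorem eLpNorm_symmetrized_le_of_nonneg {E' : Type*} [NormedAddCommGroup E'] {p : ℕ} (hp : 1 ≤ p)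
    {t : ℝ} (ht : 1 ≤ t) (r : ℕ)
    {G : Finset ι → (ι → S) → Fin p → ℝ} (hG : ∀ I, DependsOn (G I) I)
    (hGm : ∀ I, Measurable (G I)) (hG0 : ∀ I x, 0 ≤ G I x) {b : (ι → S) → E'}
    (hb : AEStronglyMeasurable b (Measure.pi fun _ : ι => P))
    (hGb : ∀ I ∈ Finset.powersetCard r Finset.univ, ∀ x, ‖G I x‖ ≤ ‖b x‖) :
    eLpNorm (symmetrized r G) (ENNReal.ofReal t)
        ((Measure.pi fun _ : ι => P).prod (Measure.pi fun _ : ι => P)) ≤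
      ENNReal.ofReal (Real.exp 1 * 6 ^ ((r : ℝ) / 2) * (t + Real.log p) ^ ((r : ℝ) / 2)) *
        ((2 ^ r * eLpNorm b (ENNReal.ofReal t) (Measure.pi fun _ : ι => P)) *
          (2 ^ r * eLpNorm (fun x => ∑ I ∈ Finset.powersetCard r Finset.univ, G I x)
            (ENNReal.ofReal t) (Measure.pi fun _ : ι => P))) ^ (1 / 2 : ℝ) := by
  have ht' : 1 ≤ ENNReal.ofReal t := by simpa using ht
  refine (eLpNorm_symmetrized_le P hp ht r hG hGm).trans (mul_le_mul_right ?_ _)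
  set a : (ι → S) × (ι → S) → Finset ι × Finset ι → ℝ := fun w IA =>
    if IA.1 ∈ Finset.powersetCard r Finset.univ ∧ IA.2 ⊆ IA.1 then ‖G IA.1 (mix IA.2 w)‖ else 0
  set d : (ι → S) × (ι → S) → Fin p → ℝ := fun w =>
    ∑ I ∈ Finset.powersetCard r Finset.univ, ∑ A ∈ I.powerset, G I (mix A w) with hd
  have ham : Measurable a := by
    refine measurable_pi_lambda _ fun IA => ?_
    by_cases h : IA.1 ∈ Finset.powersetCard r Finset.univ ∧ IA.2 ⊆ IA.1
    · simp only [a, h, if_true, and_self]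
      exact ((hGm _).comp (measurable_mix _)).norm
    · simp only [a, h, if_false]; exact measurable_const
  have hdm : Measurable d := Finset.measurable_sum _ fun I _ => Finset.measurable_sum _ fun A _ =>
    (hGm I).comp (measurable_mix A)
  have hpt : ∀ w, ‖∑ I ∈ Finset.powersetCard r Finset.univ,
      ∑ A ∈ I.powerset, G I (mix A w) ^ 2‖ ≤ ‖a w‖ * ‖d w‖ := by
    intro w
    rw [pi_norm_le_iff_of_nonneg (by positivity)]
    intro j
    simp only [Finset.sum_apply, Pi.pow_apply]
    rw [Real.norm_of_nonneg (Finset.sum_nonneg fun _ _ => Finset.sum_nonneg fun _ _ => sq_nonneg _)]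
    calc ∑ I ∈ Finset.powersetCard r Finset.univ, ∑ A ∈ I.powerset, G I (mix A w) j ^ 2
        ≤ ∑ I ∈ Finset.powersetCard r Finset.univ, ∑ A ∈ I.powerset,
            ‖a w‖ * G I (mix A w) j := by
          refine Finset.sum_le_sum fun I hI => Finset.sum_le_sum fun A hA => ?_
          rw [sq]
          refine mul_le_mul_of_nonneg_right ?_ (hG0 I _ j)
          have h1 := norm_le_pi_norm (a w) (I, A)
          simp only [a, hI, Finset.mem_powerset.1 hA, and_self, if_true, norm_norm] at h1
          exact ((le_abs_self _).trans (norm_le_pi_norm (G I (mix A w)) j)).trans h1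
      _ = ‖a w‖ * d w j := by simp only [hd, Finset.sum_apply, Finset.mul_sum]
      _ ≤ ‖a w‖ * ‖d w‖ := by
          gcongr
          exact (le_abs_self _).trans (norm_le_pi_norm (d w) j)
  calc _ ≤ eLpNorm (fun w => √(‖a w‖ * ‖d w‖)) (ENNReal.ofReal t)
          ((Measure.pi fun _ : ι => P).prod (Measure.pi fun _ : ι => P)) :=
        eLpNorm_mono_real fun w => by
          rw [Real.norm_of_nonneg (Real.sqrt_nonneg _)]
          exact Real.sqrt_le_sqrt (hpt w)
    _ ≤ _ := eLpNorm_sqrt_mul_le ham.norm hdm.norm ht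
    _ ≤ _ := by
        refine ENNReal.rpow_le_rpow ?_ (by positivity)
        rw [eLpNorm_norm, eLpNorm_norm]
        exact mul_le_mul' (eLpNorm_sup_mix_le P r hG hb hGb ht')
          (eLpNorm_sum_mix_le P r hG hGm ht')

end Norms

/-! ### Partial means -/

section Glue

variable {S : Type*}

/-- The point `(x_1, …, x_s, z_{s+1}, …, z_r)` of `S^r` (truncated if `s > r`). -/
def glue {s r : ℕ} (u : (Fin s → S) × (Fin r → S)) : Fin r → S :=
  fun i => if h : (i : ℕ) < s then u.1 ⟨i, h⟩ else u.2 i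

theorem partialMean_eq_integral_glue [MeasurableSpace S] (P : Measure S) {r : ℕ} (s : ℕ)
    (f : (Fin r → S) → ℝ) (x : Fin s → S) :
    partialMean P s f x = ∫ z, f (glue (x, z)) ∂(Measure.pi fun _ : Fin r => P) := rfl

theorem glue_glue {t s r : ℕ} (hts : t ≤ s) (x : Fin t → S) (z : Fin s → S) (w : Fin r → S) :
    glue (glue (x, z), w) = glue (x, glue (z, w)) := by
  funext i
  by_cases h1 : (i : ℕ) < t
  · have h2 : (i : ℕ) < s := by omega
    simp [glue, h1, h2]
  · by_cases h2 : (i : ℕ) < s <;> simp [glue, h1, h2]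

variable [MeasurableSpace S]

theorem measurable_glue {s r : ℕ} :
    Measurable (glue : (Fin s → S) × (Fin r → S) → Fin r → S) := by
  refine measurable_pi_lambda _ fun i => ?_
  by_cases h : (i : ℕ) < s
  · simp only [glue, h, dif_pos]; fun_prop
  · simp only [glue, h, dif_neg, not_false_eq_true]; fun_prop

variable (P : Measure S) [IsProbabilityMeasure P]

/-- Coordinates of a product measure at distinct indices form again a product measure. -/
theorem measurePreserving_comp_injective {ι κ : Type*} [Fintype ι] [Fintype κ] {e : κ → ι}
    (he : Function.Injective e) :
    MeasurePreserving (fun (x : ι → S) k => x (e k)) (Measure.pi fun _ : ι => P)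
      (Measure.pi fun _ : κ => P) := by
  refine ⟨by fun_prop, ?_⟩
  have h1 : iIndepFun (fun (i : ι) (x : ι → S) => x i) (Measure.pi fun _ : ι => P) :=
    iIndepFun_pi (μ := fun _ : ι => P) (X := fun _ => id) fun _ => aemeasurable_id
  have h2 := (iIndepFun_iff_map_fun_eq_pi_map
    (fun k => (measurable_pi_apply (e k)).aemeasurable)).1 (h1.precomp he)
  rw [h2]
  congr 1
  funext k
  exact (measurePreserving_eval (fun _ : ι => P) (e k)).map_eq

theorem measurePreserving_glue {s r : ℕ} (hsr : s ≤ r) :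
    MeasurePreserving (glue : (Fin s → S) × (Fin r → S) → Fin r → S)
      ((Measure.pi fun _ => P).prod (Measure.pi fun _ => P)) (Measure.pi fun _ => P) := by
  refine ⟨measurable_glue, ?_⟩
  have h1 := (measurePreserving_comp_injective P (Fin.castLE_injective hsr)).prod
    (MeasurePreserving.id (Measure.pi fun _ : Fin r => P))
  have h2 := measurePreserving_mix P (Finset.univ.filter fun i : Fin r => s ≤ (i : ℕ))
  calc Measure.map glue ((Measure.pi fun _ : Fin s => P).prod (Measure.pi fun _ : Fin r => P))
      = Measure.map (glue ∘ Prod.map (fun (x : Fin r → S) k => x (Fin.castLE hsr k)) id)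
          ((Measure.pi fun _ : Fin r => P).prod (Measure.pi fun _ : Fin r => P)) := by
        rw [← Measure.map_map measurable_glue h1.measurable, h1.map_eq]
    _ = Measure.map (mix (Finset.univ.filter fun i : Fin r => s ≤ (i : ℕ)))
          ((Measure.pi fun _ : Fin r => P).prod (Measure.pi fun _ : Fin r => P)) := by
        congr 1
        funext w i
        by_cases h : (i : ℕ) < s
        · simp [glue, mix, h]
        · simp [glue, mix, h, not_lt.1 h]
    _ = _ := h2.map_eq

variable {P}

theorem ae_integrable_glue {E : Type*} [NormedAddCommGroup E] {s r : ℕ} (hsr : s ≤ r)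
    {f : (Fin r → S) → E} (hf : Integrable f (Measure.pi fun _ => P)) :
    ∀ᵐ x ∂(Measure.pi fun _ : Fin s => P),
      Integrable (fun z => f (glue (x, z))) (Measure.pi fun _ => P) :=
  ((measurePreserving_glue P hsr).integrable_comp_of_integrable hf).prod_right_ae

/-- The tower property `P^{s-t} (P^{r-s} f) = P^{r-t} f`. -/
theorem partialMean_partialMean {t s r : ℕ} (hts : t ≤ s) (hsr : s ≤ r) {f : (Fin r → S) → ℝ}
    (hfm : Measurable f) (hf : Integrable f (Measure.pi fun _ => P)) :
    partialMean P t (partialMean P s f) =ᵐ[Measure.pi fun _ => P] partialMean P t f := by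
  filter_upwards [ae_integrable_glue (P := P) (hts.trans hsr) hf] with x hx
  have hmp := measurePreserving_glue P hsr
  have hm : Measurable fun y => f (glue (x, y)) :=
    hfm.comp (measurable_glue.comp measurable_prodMk_left)
  calc partialMean P t (partialMean P s f) x
      = ∫ z : Fin s → S, ∫ w : Fin r → S, f (glue (x, glue (z, w)))
          ∂(Measure.pi fun _ => P) ∂(Measure.pi fun _ => P) := by
        simp only [partialMean_eq_integral_glue, glue_glue hts]
    _ = ∫ u : (Fin s → S) × (Fin r → S), f (glue (x, glue u))
          ∂((Measure.pi fun _ => P).prod (Measure.pi fun _ => P)) :=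
        (integral_prod (fun u : (Fin s → S) × (Fin r → S) => f (glue (x, glue u)))
          (hmp.integrable_comp_of_integrable (g := fun y => f (glue (x, y))) hx)).symm
    _ = partialMean P t f x := by
        rw [← integral_map (f := fun y => f (glue (x, y))) hmp.measurable.aemeasurable
          hm.aestronglyMeasurable, hmp.map_eq, partialMean_eq_integral_glue]

theorem partialMean_congr_ae {s r : ℕ} (hsr : s ≤ r) {f g : (Fin r → S) → ℝ}
    (h : f =ᵐ[Measure.pi fun _ => P] g) :
    partialMean P s f =ᵐ[Measure.pi fun _ => P] partialMean P s g := by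
  have h1 := (measurePreserving_glue P hsr).quasiMeasurePreserving.ae h
  filter_upwards [Measure.ae_ae_of_ae_prod h1] with x hx
  exact integral_congr_ae hx

theorem partialMean_self {r : ℕ} (f : (Fin r → S) → ℝ) : partialMean P r f = f := by
  funext x
  have : ∀ z : Fin r → S, glue (x, z) = x := fun z => by funext i; simp [glue]
  simp [partialMean_eq_integral_glue, this]

/-- A degenerate kernel has mean zero in any nonempty set of its arguments. -/
theorem IsDegenerate.partialMean_ae_eq_zero {s r : ℕ} (hsr : s < r) {f : (Fin r → S) → ℝ}
    (hfm : Measurable f) (hf : Integrable f (Measure.pi fun _ => P)) (hdeg : IsDegenerate P f) :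
    partialMean P s f =ᵐ[Measure.pi fun _ => P] 0 := by
  have h1 : partialMean P (r - 1) f =ᵐ[Measure.pi fun _ => P] fun _ => (0 : ℝ) := hdeg
  have h2 := partialMean_congr_ae (P := P) (s := s) (by omega) h1
  have h3 := partialMean_partialMean (P := P) (t := s) (s := r - 1) (by omega) (by omega) hfm hf
  filter_upwards [h2, h3] with x hx2 hx3
  rw [← hx3, hx2]
  simp [partialMean_eq_integral_glue]

theorem measurable_partialMean {s r : ℕ} {f : (Fin r → S) → ℝ} (hf : Measurable f) :
    Measurable (partialMean P s f) :=
  (StronglyMeasurable.integral_prod_right' (hf.comp measurable_glue).stronglyMeasurable).measurable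

variable (P) in
/-- The partial means `P^{r-s} f_j` of the components of a family `f = (f_1, …, f_p)` of kernels. -/
noncomputable def vecMean {r p : ℕ} (s : ℕ) (f : (Fin r → S) → Fin p → ℝ) (x : Fin s → S) :
    Fin p → ℝ :=
  fun j => partialMean P s (fun y => f y j) x

variable {r p : ℕ} {f : (Fin r → S) → Fin p → ℝ}

theorem vecMean_self : vecMean P r f = f := by
  funext x j
  simp only [vecMean, partialMean_self]

theorem measurable_vecMean {s : ℕ} (hf : Measurable f) : Measurable (vecMean P s f) :=
  measurable_pi_lambda _ fun j => measurable_partialMean ((measurable_pi_apply j).comp hf)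

omit [IsProbabilityMeasure P] in
theorem vecMean_nonneg {s : ℕ} (hf : ∀ x, 0 ≤ f x) (x : Fin s → S) : 0 ≤ vecMean P s f x :=
  fun j => integral_nonneg fun _ => hf _ j

theorem vecMean_vecMean {t s : ℕ} (hts : t ≤ s) (hsr : s ≤ r)
    (hfm : Measurable f) (hf : Integrable f (Measure.pi fun _ => P)) :
    vecMean P t (vecMean P s f) =ᵐ[Measure.pi fun _ => P] vecMean P t f := by
  have h := fun j => partialMean_partialMean (P := P) hts hsr
    ((measurable_pi_apply j).comp hfm) (hf.eval j)
  filter_upwards [ae_all_iff.2 h] with x hx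
  funext j
  exact hx j

omit [IsProbabilityMeasure P] in
theorem vecMean_perm {s : ℕ} (hsr : s ≤ r)
    (hs : ∀ (σ : Equiv.Perm (Fin r)) (x : Fin r → S), f (fun i => x (σ i)) = f x)
    (σ : Equiv.Perm (Fin s)) (x : Fin s → S) :
    vecMean P s f (fun i => x (σ i)) = vecMean P s f x := by
  set e : Fin s ≃ {i : Fin r // (i : ℕ) < s} :=
    ⟨fun i => ⟨⟨i, by omega⟩, i.2⟩, fun i => ⟨i.1, i.2⟩, fun _ => rfl, fun _ => rfl⟩
  have key : ∀ z : Fin r → S,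
      glue (fun i => x (σ i), z) = fun i => glue (x, z) (σ.extendDomain e i) := by
    intro z
    funext i
    by_cases h : (i : ℕ) < s
    · rw [Equiv.Perm.extendDomain_apply_subtype σ e h]
      simp [glue, h, e]
    · rw [Equiv.Perm.extendDomain_apply_not_subtype σ e h]
      simp [glue, h]
  funext j
  simp only [vecMean, partialMean_eq_integral_glue, key, hs]

theorem ae_vecMean_eq_integral {s : ℕ} (hsr : s ≤ r) (hf : Integrable f (Measure.pi fun _ => P)) :
    ∀ᵐ x ∂(Measure.pi fun _ : Fin s => P),
      vecMean P s f x = ∫ z, f (glue (x, z)) ∂(Measure.pi fun _ : Fin r => P) := by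
  filter_upwards [ae_integrable_glue (P := P) hsr hf] with x hx
  funext j
  rw [eval_integral fun j => hx.eval j]
  rfl

theorem memLp_vecMean {s : ℕ} (hsr : s ≤ r) (hfm : Measurable f) {t : ℝ} (ht : 1 ≤ t)
    (hf : MemLp f (ENNReal.ofReal t) (Measure.pi fun _ => P)) :
    MemLp (vecMean P s f) (ENNReal.ofReal t) (Measure.pi fun _ => P) := by
  refine ⟨(measurable_vecMean hfm).aestronglyMeasurable, lt_of_le_of_lt ?_ hf.2⟩
  have ht' : 1 ≤ ENNReal.ofReal t := by simpa using ht
  have hmp := measurePreserving_glue P hsr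
  rw [← eLpNorm_comp_measurePreserving hf.1 hmp]
  refine eLpNorm_le_of_enorm_le_lintegral (hfm.comp measurable_glue) ht ?_
  filter_upwards [ae_vecMean_eq_integral (P := P) hsr (hf.integrable ht')] with x hx
  rw [hx]
  exact enorm_integral_le_lintegral_enorm _

end Glue

/-! ### Kernels evaluated on a sample -/

section Sampled

variable {S : Type*} {n : ℕ}

/-- The value of the kernel `f` of order `r` at the coordinates of the sample `x` with index in
`I`, taken in increasing order; zero unless `I` has `r` elements. -/
def sampled {E : Type*} [Zero E] {r : ℕ} (f : (Fin r → S) → E) (I : Finset (Fin n))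
    (x : Fin n → S) : E :=
  if h : I.card = r then f (fun k => x (I.orderEmbOfFin h k)) else 0

/-- The sum of the values of `f` over all increasing `r`-tuples of sample points. -/
def usum {E : Type*} [AddCommMonoid E] {r : ℕ} (f : (Fin r → S) → E) (x : Fin n → S) : E :=
  ∑ I ∈ Finset.powersetCard r Finset.univ, sampled f I x

theorem sampled_eq {E : Type*} [Zero E] {r : ℕ} (f : (Fin r → S) → E) {I : Finset (Fin n)}
    (h : I.card = r) (x : Fin n → S) :
    sampled f I x = f (fun k => x (I.orderEmbOfFin h k)) := dif_pos h

theorem usum_eq_sum_orderEmb {E : Type*} [AddCommMonoid E] {r : ℕ} (f : (Fin r → S) → E)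
    (x : Fin n → S) : usum f x = ∑ i : Fin r ↪o Fin n, f (fun k => x (i k)) := by
  refine Finset.sum_bij' (fun I hI => I.orderEmbOfFin (Finset.mem_powersetCard.1 hI).2)
    (fun e _ => Finset.univ.map e.toEmbedding) (fun _ _ => Finset.mem_univ _)
    (fun e _ => by simp [Finset.mem_powersetCard]) (fun I hI => ?_) (fun e _ => ?_)
    (fun I hI => ?_)
  · exact Finset.map_orderEmbOfFin_univ I _
  · exact (Finset.orderEmbOfFin_unique' _ fun k => by simp).symm
  · exact sampled_eq f (Finset.mem_powersetCard.1 hI).2 x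

theorem dependsOn_sampled {E : Type*} [Zero E] {r : ℕ} (f : (Fin r → S) → E)
    (I : Finset (Fin n)) : DependsOn (sampled f I) I := by
  intro x y h
  unfold sampled
  split_ifs with hI
  · congr 1
    funext k
    exact h _ (Finset.orderEmbOfFin_mem I hI k)
  · rfl

/-- A symmetric kernel may be evaluated along any enumeration of `I`. -/
theorem sampled_eq_of_injective {E : Type*} [Zero E] {r : ℕ} {f : (Fin r → S) → E}
    (hs : ∀ (σ : Equiv.Perm (Fin r)) (x : Fin r → S), f (fun i => x (σ i)) = f x)
    {I : Finset (Fin n)} {e : Fin r → Fin n} (he : Function.Injective e)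
    (heI : Finset.univ.image e = I) (x : Fin n → S) : sampled f I x = f (fun k => x (e k)) := by
  have hI : I.card = r := by rw [← heI, Finset.card_image_of_injective _ he]; simp
  have hex : ∀ k, ∃ l, I.orderEmbOfFin hI l = e k := fun k => by
    have h : e k ∈ Set.range (I.orderEmbOfFin hI) := by
      rw [Finset.range_orderEmbOfFin, ← heI]
      simp
    exact h
  choose g hg using hex
  have hgi : Function.Injective g := fun k l hkl => he (by rw [← hg, ← hg, hkl])
  rw [sampled_eq f hI, ← hs (Equiv.ofBijective g (Finite.injective_iff_bijective.1 hgi))]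
  simp [hg]

variable [MeasurableSpace S]

theorem measurable_sampled {E : Type*} [Zero E] [MeasurableSpace E] {r : ℕ} {f : (Fin r → S) → E}
    (hf : Measurable f) (I : Finset (Fin n)) : Measurable (sampled f I) := by
  unfold sampled
  split_ifs with h
  · exact hf.comp (by fun_prop)
  · exact measurable_const

variable {P : Measure S} [IsProbabilityMeasure P] {r p : ℕ} {f : (Fin r → S) → Fin p → ℝ}

theorem memLp_sampled {m : ℝ≥0∞} (hf : MemLp f m (Measure.pi fun _ => P)) (I : Finset (Fin n)) :
    MemLp (sampled f I) m (Measure.pi fun _ => P) := by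
  unfold sampled
  split_ifs with h
  · exact hf.comp_measurePreserving
      (measurePreserving_comp_injective P (I.orderEmbOfFin h).injective)
  · exact MemLp.zero

/-- Integrating out the coordinates in `A ⊆ I` turns the kernel `f` at `I` into its partial mean at
`I \ A`. -/
theorem integral_sampled_mix (hfm : Measurable f)
    (hs : ∀ (σ : Equiv.Perm (Fin r)) (x : Fin r → S), f (fun i => x (σ i)) = f x)
    {s : ℕ} {I A : Finset (Fin n)} (hI : I.card = r) (hAI : A ⊆ I) (hA : (I \ A).card = s)
    (x : Fin n → S) (j : Fin p) :
    ∫ x', sampled f I (mix A (x, x')) j ∂(Measure.pi fun _ : Fin n => P) =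
      sampled (vecMean P s f) (I \ A) x j := by
  set eK := (I \ A).orderEmbOfFin hA
  set eA := A.orderEmbOfFin rfl
  have hcard : s + A.card = r := by
    rw [← hA, Finset.card_sdiff_add_card_eq_card hAI, hI]
  -- an enumeration of `I` that lists `I \ A` first
  set e : Fin r → Fin n := fun i =>
    if h : (i : ℕ) < s then eK ⟨i, h⟩ else eA ⟨i - s, by omega⟩ with he
  have hK : ∀ i, eK i ∈ I \ A := Finset.orderEmbOfFin_mem _ hA
  have hA' : ∀ i, eA i ∈ A := Finset.orderEmbOfFin_mem _ rfl
  have heK : ∀ (i : Fin r) (h : (i : ℕ) < s), e i = eK ⟨i, h⟩ := fun i h => by simp [he, h]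
  have heA : ∀ (i : Fin r) (h : ¬ (i : ℕ) < s), e i = eA ⟨i - s, by omega⟩ := fun i h => by simp [he, h]
  have hmem : ∀ i, e i ∈ A ↔ ¬ (i : ℕ) < s := by
    intro i
    by_cases h : (i : ℕ) < s
    · simpa [heK i h, h] using (Finset.mem_sdiff.1 (hK ⟨i, h⟩)).2
    · simp only [heA i h, h, hA', not_false_eq_true]
  have hinj : Function.Injective e := by
    intro i k hik
    have hiff : ((i : ℕ) < s) ↔ ((k : ℕ) < s) := by
      have := (hmem i).symm.trans ((by rw [hik] : e i ∈ A ↔ e k ∈ A).trans (hmem k))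
      tauto
    by_cases h : (i : ℕ) < s
    · rw [heK i h, heK k (hiff.1 h)] at hik
      have := congrArg Fin.val (eK.injective hik)
      exact Fin.ext this
    · have h' : ¬ (k : ℕ) < s := fun hh => h (hiff.2 hh)
      rw [heA i h, heA k h'] at hik
      have := congrArg Fin.val (eA.injective hik)
      simp only at this
      exact Fin.ext (by omega)
  have himg : Finset.univ.image e = I := by
    refine Finset.eq_of_subset_of_card_le (fun y hy => ?_) ?_
    · obtain ⟨i, -, rfl⟩ := Finset.mem_image.1 hy
      by_cases h : (i : ℕ) < s
      · rw [heK i h]; exact (Finset.mem_sdiff.1 (hK _)).1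
      · rw [heA i h]; exact hAI (hA' _)
    · rw [Finset.card_image_of_injective _ hinj, hI]; simp
  have hmix : ∀ x' : Fin n → S, (fun k => mix A (x, x') (e k)) =
      glue (fun i => x (eK i), fun k => x' (e k)) := by
    intro x'
    funext k
    by_cases h : (k : ℕ) < s
    · have hkA := (Finset.mem_sdiff.1 (hK ⟨k, h⟩)).2
      simp [mix, glue, h, heK k h, hkA]
    · simp [mix, glue, hmem, h]
  have hmp := measurePreserving_comp_injective P hinj
  have hm : Measurable fun z => f (glue (fun i => x (eK i), z)) j :=
    (measurable_pi_apply j).comp (hfm.comp (measurable_glue.comp measurable_prodMk_left))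
  simp only [sampled_eq_of_injective hs hinj himg, hmix]
  rw [sampled_eq _ hA, vecMean, partialMean_eq_integral_glue, ← hmp.map_eq,
    integral_map hmp.measurable.aemeasurable hm.aestronglyMeasurable]

end Sampled

/-! ### The mean of the symmetrised sum over the second sample -/

section Expansion

theorem sampled_nonneg {S : Type*} {n : ℕ} {E : Type*} [Zero E] [Preorder E] {s : ℕ} {g : (Fin s → S) → E}
    (hg : ∀ x, 0 ≤ g x) (I : Finset (Fin n)) (x : Fin n → S) : 0 ≤ sampled g I x := by
  unfold sampled
  split_ifs
  · exact hg _
  · exact le_rfl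

/-- Each set of size `r - j` arises as `I \ A` from at most `n^j` pairs `(I, A)`. -/
theorem sum_powersetCard_sdiff_le {n r j : ℕ} {k : Finset (Fin n) → ℝ}
    (hk : ∀ K, 0 ≤ k K) :
    ∑ I ∈ Finset.powersetCard r Finset.univ, ∑ A ∈ Finset.powersetCard j I, k (I \ A) ≤
      (n : ℝ) ^ j * ∑ K ∈ Finset.powersetCard (r - j) Finset.univ, k K := by
  set Z := (Finset.powersetCard j (Finset.univ : Finset (Fin n))) ×ˢ
    (Finset.powersetCard (r - j) (Finset.univ : Finset (Fin n)))
  set T := (Finset.powersetCard r (Finset.univ : Finset (Fin n))).sigma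
    fun I => Finset.powersetCard j I
  calc ∑ I ∈ Finset.powersetCard r Finset.univ, ∑ A ∈ Finset.powersetCard j I, k (I \ A)
      = ∑ u ∈ T, k (u.1 \ u.2) := Finset.sum_sigma' _ _ fun I A => k (I \ A)
    _ = ∑ v ∈ T.image (fun u => (u.2, u.1 \ u.2)), k v.2 := by
        rw [Finset.sum_image]
        rintro ⟨I, A⟩ h1 ⟨I', A'⟩ h2 h
        simp only [Finset.mem_coe, T, Finset.mem_sigma, Finset.mem_powersetCard] at h1 h2
        simp only [Prod.mk.injEq] at h
        obtain ⟨rfl, h⟩ := h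
        have : I = I' := by
          rw [← Finset.sdiff_union_of_subset h1.2.1, h, Finset.sdiff_union_of_subset h2.2.1]
        rw [this]
    _ ≤ ∑ v ∈ Z, k v.2 := by
        refine Finset.sum_le_sum_of_subset_of_nonneg (fun v hv => ?_) fun _ _ _ => hk _
        obtain ⟨⟨I, A⟩, hu, rfl⟩ := Finset.mem_image.1 hv
        simp only [T, Finset.mem_sigma, Finset.mem_powersetCard] at hu
        simp only [Z, Finset.mem_product, Finset.mem_powersetCard, Finset.subset_univ, true_and]
        refine ⟨hu.2.2, ?_⟩
        rw [Finset.card_sdiff_of_subset hu.2.1, hu.1.2, hu.2.2]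
    _ = (n.choose j : ℝ) * ∑ K ∈ Finset.powersetCard (r - j) Finset.univ, k K := by
        rw [Finset.sum_product]
        simp
    _ ≤ _ := by
        gcongr
        · exact Finset.sum_nonneg fun _ _ => hk _
        · exact_mod_cast Nat.choose_le_pow n j

variable {S : Type*} [MeasurableSpace S] {n : ℕ} (P : Measure S) {r p : ℕ}

/-- The part of the mean of the symmetrised sum over the second sample in which `j` of the
`r` arguments have been integrated out, without its sign `(-1)^j`. -/
noncomputable def integratedPart (j : ℕ) (f : (Fin r → S) → Fin p → ℝ) (x : Fin n → S) :
    Fin p → ℝ :=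
  ∑ I ∈ Finset.powersetCard r Finset.univ, ∑ A ∈ Finset.powersetCard j I,
    sampled (vecMean P (r - j) f) (I \ A) x

variable {f : (Fin r → S) → Fin p → ℝ}

theorem measurable_usum {s : ℕ} {g : (Fin s → S) → Fin p → ℝ} (hg : Measurable g) :
    Measurable (usum g : (Fin n → S) → Fin p → ℝ) :=
  Finset.measurable_sum _ fun I _ => measurable_sampled hg I

theorem measurable_integratedPart [IsProbabilityMeasure P] (j : ℕ) (hf : Measurable f) :
    Measurable (integratedPart P j f : (Fin n → S) → Fin p → ℝ) :=
  Finset.measurable_sum _ fun _ _ => Finset.measurable_sum _ fun _ _ =>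
    measurable_sampled (measurable_vecMean hf) _

theorem norm_integratedPart_le (hf : ∀ x, 0 ≤ f x) (j : ℕ) (x : Fin n → S) :
    ‖integratedPart P j f x‖ ≤ (n : ℝ) ^ j * ‖usum (vecMean P (r - j) f) x‖ := by
  have h0 : ∀ K, 0 ≤ sampled (vecMean P (r - j) f) K x :=
    fun K => sampled_nonneg (vecMean_nonneg hf) K x
  rw [pi_norm_le_iff_of_nonneg (by positivity)]
  intro i
  have h1 := sum_powersetCard_sdiff_le (n := n) (r := r) (j := j) fun K => h0 K i
  have h2 : ∑ K ∈ Finset.powersetCard (r - j) Finset.univ, sampled (vecMean P (r - j) f) K x i =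
      usum (vecMean P (r - j) f) x i := by simp [usum]
  simp only [integratedPart, Finset.sum_apply]
  rw [Real.norm_of_nonneg (Finset.sum_nonneg fun _ _ => Finset.sum_nonneg fun _ _ => h0 _ i)]
  refine h1.trans ?_
  rw [h2]
  gcongr
  exact (le_abs_self _).trans (norm_le_pi_norm (usum (vecMean P (r - j) f) x) i)

variable [IsProbabilityMeasure P]

theorem integratedPart_zero :
    (integratedPart P 0 f : (Fin n → S) → Fin p → ℝ) = usum f := by
  funext x
  simp [integratedPart, usum, vecMean_self]

/-- The mean of the symmetrised sum over the second sample. The identity holds almost surely only,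
since some sections of `f` may fail to be integrable. -/
theorem ae_integral_symmetrized (hfm : Measurable f)
    (hs : ∀ (σ : Equiv.Perm (Fin r)) (x : Fin r → S), f (fun i => x (σ i)) = f x)
    (hf : Integrable f (Measure.pi fun _ => P)) :
    ∀ᵐ x ∂(Measure.pi fun _ : Fin n => P),
      ∫ x', symmetrized r (sampled f) (x, x') ∂(Measure.pi fun _ : Fin n => P) =
        ∑ j ∈ Finset.range (r + 1), (-1 : ℝ) ^ j • integratedPart P j f x := by
  have hint : ∀ I A : Finset (Fin n), ∀ᵐ x ∂(Measure.pi fun _ : Fin n => P),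
      Integrable (fun x' => sampled f I (mix A (x, x'))) (Measure.pi fun _ : Fin n => P) := by
    intro I A
    have h1 := memLp_one_iff_integrable.1
      (memLp_sampled (n := n) (memLp_one_iff_integrable.2 hf) I)
    exact ((measurePreserving_mix P A).integrable_comp_of_integrable h1).prod_right_ae
  filter_upwards [ae_all_iff.2 fun I => ae_all_iff.2 (hint I)] with x hx
  have hsm : ∀ I A : Finset (Fin n),
      Integrable (fun x' => (-1 : ℝ) ^ A.card • sampled f I (mix A (x, x')))
        (Measure.pi fun _ : Fin n => P) := fun I A =>
    (hx I A).smul ((-1 : ℝ) ^ A.card)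
  simp only [symmetrized]
  rw [integral_finsetSum _ fun I _ => integrable_finsetSum _ fun A _ => hsm I A]
  simp only [integratedPart, Finset.smul_sum]
  rw [Finset.sum_comm]
  refine Finset.sum_congr rfl fun I hI => ?_
  have hI' := (Finset.mem_powersetCard.1 hI).2
  rw [integral_finsetSum _ fun A _ => hsm I A, Finset.sum_powerset, hI']
  refine Finset.sum_congr rfl fun j _ => Finset.sum_congr rfl fun A hA => ?_
  obtain ⟨hAI, hAj⟩ := Finset.mem_powersetCard.1 hA
  rw [integral_smul, hAj]
  congr 1
  funext i
  rw [eval_integral fun i => (hx I A).eval i]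
  exact integral_sampled_mix hfm hs hI' hAI
    (by rw [Finset.card_sdiff_of_subset hAI, hI', hAj]) x i

theorem eLpNorm_sum_integratedPart_le {t : ℝ} (ht : 1 ≤ t) (hfm : Measurable f)
    (hs : ∀ (σ : Equiv.Perm (Fin r)) (x : Fin r → S), f (fun i => x (σ i)) = f x)
    (hf : Integrable f (Measure.pi fun _ => P)) :
    eLpNorm (fun x : Fin n → S =>
        ∑ j ∈ Finset.range (r + 1), (-1 : ℝ) ^ j • integratedPart P j f x)
        (ENNReal.ofReal t) (Measure.pi fun _ => P) ≤
      eLpNorm (symmetrized r (sampled f)) (ENNReal.ofReal t)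
        ((Measure.pi fun _ : Fin n => P).prod (Measure.pi fun _ : Fin n => P)) := by
  have hm : Measurable (symmetrized r (sampled f) :
      (Fin n → S) × (Fin n → S) → Fin p → ℝ) := by
    refine Finset.measurable_sum _ fun I _ => Finset.measurable_sum _ fun A _ => ?_
    exact ((measurable_sampled hfm I).comp (measurable_mix A)).const_smul ((-1 : ℝ) ^ A.card)
  refine eLpNorm_le_of_enorm_le_lintegral hm ht ?_
  filter_upwards [ae_integral_symmetrized (n := n) P hfm hs hf] with x hx
  rw [← hx]
  exact enorm_integral_le_lintegral_enorm _

theorem sampled_ae_eq_zero {s : ℕ} {g : (Fin s → S) → Fin p → ℝ}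
    (hg : g =ᵐ[Measure.pi fun _ => P] 0) (I : Finset (Fin n)) :
    sampled g I =ᵐ[Measure.pi fun _ => P] 0 := by
  by_cases h : I.card = s
  · have := (measurePreserving_comp_injective P
      (I.orderEmbOfFin h).injective).quasiMeasurePreserving.ae hg
    filter_upwards [this] with x hx
    rw [sampled_eq g h]
    exact hx
  · exact Filter.Eventually.of_forall fun x => by simp [sampled, h]

/-- Symmetrisation of degenerate U-statistics, with the moment bound for chaoses. -/
theorem eLpNorm_usum_le_of_degenerate (hp : 1 ≤ p) {q : ℝ} (hq : 2 ≤ q) (hfm : Measurable f)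
    (hs : ∀ (σ : Equiv.Perm (Fin r)) (x : Fin r → S), f (fun i => x (σ i)) = f x)
    (hf : Integrable f (Measure.pi fun _ => P))
    (hdeg : ∀ i, IsDegenerate P fun x => f x i) :
    eLpNorm (usum f) (ENNReal.ofReal q) (Measure.pi fun _ : Fin n => P) ≤
      ENNReal.ofReal (Real.exp 1 * 6 ^ ((r : ℝ) / 2) * (q + Real.log p) ^ ((r : ℝ) / 2)) *
        (2 ^ r * eLpNorm (usum fun y => f y ^ 2) (ENNReal.ofReal (q / 2))
          (Measure.pi fun _ : Fin n => P)) ^ (1 / 2 : ℝ) := by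
  have hae : (usum f : (Fin n → S) → Fin p → ℝ) =ᵐ[Measure.pi fun _ => P]
      fun x => ∑ j ∈ Finset.range (r + 1), (-1 : ℝ) ^ j • integratedPart P j f x := by
    have h0 : ∀ s < r, vecMean P s f =ᵐ[Measure.pi fun _ => P] 0 := by
      intro s hsr
      have := fun i => (hdeg i).partialMean_ae_eq_zero hsr
        ((measurable_pi_apply i).comp hfm) (hf.eval i)
      filter_upwards [ae_all_iff.2 this] with x hx
      funext i
      exact hx i
    have h1 : ∀ s : Fin r, ∀ I : Finset (Fin n),
        sampled (vecMean P s f) I =ᵐ[Measure.pi fun _ => P] 0 :=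
      fun s I => sampled_ae_eq_zero P (h0 s s.2) I
    filter_upwards [ae_all_iff.2 fun s => ae_all_iff.2 (h1 s)] with x hx
    rw [Finset.sum_range_succ', integratedPart_zero, Finset.sum_eq_zero]
    · simp
    · intro j hj
      rw [integratedPart, Finset.sum_eq_zero, smul_zero]
      intro I _
      refine Finset.sum_eq_zero fun A _ => ?_
      exact hx ⟨r - (j + 1), by have := Finset.mem_range.1 hj; omega⟩ (I \ A)
  have hq1 : 1 ≤ q := by linarith
  have hq2 : 1 ≤ q / 2 := by linarith
  rw [eLpNorm_congr_ae hae]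
  refine (eLpNorm_sum_integratedPart_le P hq1 hfm hs hf).trans ?_
  refine (eLpNorm_symmetrized_le P hp hq1 r (dependsOn_sampled f)
    (measurable_sampled hfm)).trans (mul_le_mul_right ?_ _)
  have hsq : ∀ (I : Finset (Fin n)) x, sampled f I x ^ 2 = sampled (fun y => f y ^ 2) I x := by
    intro I x
    unfold sampled
    split_ifs <;> simp
  simp only [hsq]
  have h := eLpNorm_sum_mix_le P r (dependsOn_sampled (n := n) fun y => f y ^ 2)
    (measurable_sampled (hfm.pow_const 2)) (m := ENNReal.ofReal (q / 2)) (by simpa using hq2)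
  refine le_trans (le_of_eq ?_) (ENNReal.rpow_le_rpow h (by positivity))
  rw [eLpNorm_ofReal _ _ hq1, eLpNorm_ofReal _ _ hq2, ← ENNReal.rpow_mul]
  congr 1
  · refine lintegral_congr fun w => ?_
    rw [Real.enorm_of_nonneg (Real.sqrt_nonneg _), ← ofReal_norm,
      Real.sqrt_eq_rpow, ← ENNReal.ofReal_rpow_of_nonneg (norm_nonneg _) (by positivity),
      ← ENNReal.rpow_mul]
    congr 1
    ring
  · field_simp

end Expansion

/-! ### U-statistics with nonnegative kernels -/

section Nonneg

/-- Solving the self-bounding inequality `V ≤ c √(X V) + W` for `V`. -/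
theorem le_of_le_mul_sqrt_add {V X W c : ℝ≥0∞} (hV : V ≠ ∞)
    (h : V ≤ c * (X * V) ^ (1 / 2 : ℝ) + W) : V ≤ c ^ 2 * X + 2 * W := by
  have hy := ENNReal.young_inequality (c * X ^ (1 / 2 : ℝ)) (V ^ (1 / 2 : ℝ))
    Real.HolderConjugate.two_two
  have hsq : ∀ x : ℝ≥0∞, (x ^ (1 / 2 : ℝ)) ^ (2 : ℝ) = x := fun x => by
    rw [← ENNReal.rpow_mul]; norm_num
  rw [ENNReal.mul_rpow_of_nonneg _ _ zero_le_two, hsq, hsq, mul_assoc,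
    ← ENNReal.mul_rpow_of_nonneg _ _ (by norm_num), ENNReal.ofReal_ofNat, ENNReal.rpow_two] at hy
  have h2 : V + V ≤ c ^ 2 * X + V + 2 * W := by
    calc V + V = 2 * V := (two_mul V).symm
      _ ≤ 2 * (c * (X * V) ^ (1 / 2 : ℝ) + W) := by gcongr
      _ ≤ 2 * ((c ^ 2 * X / 2 + V / 2) + W) := by gcongr
      _ = c ^ 2 * X + V + 2 * W := by
        rw [mul_add, mul_add, ENNReal.mul_div_cancel (by simp) (by simp),
          ENNReal.mul_div_cancel (by simp) (by simp)]
  rw [add_right_comm] at h2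
  exact (ENNReal.add_le_add_iff_right hV).1 h2

variable {S : Type*} {n r p : ℕ}

/-- The values of the kernels `f_1, …, f_p` at all tuples of distinct sample points; its norm is the
maximum `max_j M(f_j)`. -/
def tupleValues (f : (Fin r → S) → Fin p → ℝ) (x : Fin n → S) :
    (Fin r ↪ Fin n) → Fin p → ℝ :=
  fun i => f fun k => x (i k)

theorem norm_sampled_le (f : (Fin r → S) → Fin p → ℝ) (I : Finset (Fin n)) (x : Fin n → S) :
    ‖sampled f I x‖ ≤ ‖tupleValues f x‖ := by
  by_cases h : I.card = r
  · rw [sampled_eq f h]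
    exact norm_le_pi_norm (tupleValues f x) (I.orderEmbOfFin h).toEmbedding
  · simp [sampled, h]

variable [MeasurableSpace S]

theorem measurable_tupleValues {f : (Fin r → S) → Fin p → ℝ} (hf : Measurable f) :
    Measurable (tupleValues f : (Fin n → S) → (Fin r ↪ Fin n) → Fin p → ℝ) :=
  measurable_pi_lambda _ fun _ => hf.comp (by fun_prop)

variable {P : Measure S} [IsProbabilityMeasure P] {f : (Fin r → S) → Fin p → ℝ}

theorem tupleValues_congr_ae {g : (Fin r → S) → Fin p → ℝ} (h : f =ᵐ[Measure.pi fun _ => P] g) :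
    (tupleValues f : (Fin n → S) → (Fin r ↪ Fin n) → Fin p → ℝ) =ᵐ[Measure.pi fun _ => P]
      tupleValues g := by
  have h1 := fun i : Fin r ↪ Fin n =>
    (measurePreserving_comp_injective P i.injective).quasiMeasurePreserving.ae h
  filter_upwards [ae_all_iff.2 h1] with x hx
  funext i
  exact hx i

/-- The bound for a U-statistic with nonnegative kernels in terms of those of lower order. -/
theorem eLpNorm_usum_le_add (hp : 1 ≤ p) {m : ℝ} (hm : 1 ≤ m) (hfm : Measurable f)
    (hs : ∀ (σ : Equiv.Perm (Fin r)) (x : Fin r → S), f (fun i => x (σ i)) = f x)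
    (hf0 : ∀ x, 0 ≤ f x) (hf : MemLp f (ENNReal.ofReal m) (Measure.pi fun _ => P)) :
    eLpNorm (usum f) (ENNReal.ofReal m) (Measure.pi fun _ : Fin n => P) ≤
      ENNReal.ofReal (Real.exp 1 * 6 ^ ((r : ℝ) / 2)) ^ 2 * 4 ^ r *
          (ENNReal.ofReal (m + Real.log p) ^ r *
            eLpNorm (tupleValues f) (ENNReal.ofReal m) (Measure.pi fun _ : Fin n => P)) +
        2 * ∑ j ∈ Finset.range r, (n : ℝ≥0∞) ^ (j + 1) *
          eLpNorm (usum (vecMean P (r - (j + 1)) f)) (ENNReal.ofReal m)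
            (Measure.pi fun _ : Fin n => P) := by
  have hlog : 0 ≤ Real.log p := Real.log_natCast_nonneg p
  have hm' : 1 ≤ ENNReal.ofReal m := by simpa using hm
  set V := eLpNorm (usum f) (ENNReal.ofReal m) (Measure.pi fun _ : Fin n => P) with hV
  set b := eLpNorm (tupleValues f) (ENNReal.ofReal m) (Measure.pi fun _ : Fin n => P)
  set W := ∑ j ∈ Finset.range r, (n : ℝ≥0∞) ^ (j + 1) *
    eLpNorm (usum (vecMean P (r - (j + 1)) f)) (ENNReal.ofReal m) (Measure.pi fun _ : Fin n => P)
    with hW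
  have hVtop : V ≠ ∞ := by
    have : MemLp (usum f) (ENNReal.ofReal m) (Measure.pi fun _ : Fin n => P) :=
      memLp_finsetSum _ fun I _ => memLp_sampled hf I
    exact this.2.ne
  set R : (Fin n → S) → Fin p → ℝ := fun x =>
    ∑ j ∈ Finset.range (r + 1), (-1 : ℝ) ^ j • integratedPart P j f x with hR
  have hI := fun j => measurable_integratedPart (n := n) P j hfm
  have hRm : Measurable R := Finset.measurable_sum _ fun j _ => (hI j).const_smul ((-1 : ℝ) ^ j)
  -- the term `j = 0` of the mean `R` of the symmetrised sum is the U-statistic itself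
  have hdecomp : (usum f : (Fin n → S) → Fin p → ℝ) =
      R - ∑ j ∈ Finset.range r, (-1 : ℝ) ^ (j + 1) • integratedPart P (j + 1) f := by
    funext x
    simp only [hR, Finset.sum_range_succ', integratedPart_zero, Pi.sub_apply, Finset.sum_apply,
      Pi.smul_apply, pow_zero, one_smul, add_sub_cancel_left]
  have h1 : V ≤ eLpNorm R (ENNReal.ofReal m) (Measure.pi fun _ : Fin n => P) + W := by
    rw [hV, hdecomp]
    refine (eLpNorm_sub_le hRm.aestronglyMeasurable (Finset.aestronglyMeasurable_sum _ fun j _ =>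
      ((hI (j + 1)).const_smul ((-1 : ℝ) ^ (j + 1))).aestronglyMeasurable) hm').trans ?_
    gcongr
    refine (eLpNorm_sum_le (fun j _ =>
      ((hI (j + 1)).const_smul ((-1 : ℝ) ^ (j + 1))).aestronglyMeasurable) hm').trans ?_
    refine Finset.sum_le_sum fun j _ => ?_
    have h2 : eLpNorm ((-1 : ℝ) ^ (j + 1) • (integratedPart P (j + 1) f :
          (Fin n → S) → Fin p → ℝ)) (ENNReal.ofReal m) (Measure.pi fun _ : Fin n => P) ≤
        ENNReal.ofReal ((n : ℝ) ^ (j + 1)) * eLpNorm (usum (vecMean P (r - (j + 1)) f))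
          (ENNReal.ofReal m) (Measure.pi fun _ : Fin n => P) := by
      refine eLpNorm_le_mul_eLpNorm_of_ae_le_mul (Filter.Eventually.of_forall fun x => ?_) _
      rw [Pi.smul_apply, norm_smul, norm_pow, norm_neg, norm_one, one_pow, one_mul]
      exact norm_integratedPart_le P hf0 (j + 1) x
    rwa [ENNReal.ofReal_pow (Nat.cast_nonneg n), ENNReal.ofReal_natCast] at h2
  have h2 := (eLpNorm_sum_integratedPart_le (n := n) P hm hfm hs (hf.integrable hm')).trans
    (eLpNorm_symmetrized_le_of_nonneg P hp hm r (dependsOn_sampled f) (measurable_sampled hfm)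
      (sampled_nonneg hf0) (measurable_tupleValues hfm).aestronglyMeasurable
      fun I _ x => norm_sampled_le f I x)
  have h3 : V ≤ ENNReal.ofReal (Real.exp 1 * 6 ^ ((r : ℝ) / 2) *
      (m + Real.log p) ^ ((r : ℝ) / 2)) * ((2 ^ r * b * 2 ^ r) * V) ^ (1 / 2 : ℝ) + W := by
    refine h1.trans (add_le_add ?_ le_rfl)
    rw [mul_assoc (2 ^ r * b)]
    exact h2
  refine (le_of_le_mul_sqrt_add hVtop h3).trans (le_of_eq ?_)
  congr 1
  have hL : ENNReal.ofReal ((m + Real.log p) ^ ((r : ℝ) / 2)) ^ 2 =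
      ENNReal.ofReal (m + Real.log p) ^ r := by
    rw [← ENNReal.ofReal_pow (by positivity), ← ENNReal.ofReal_pow (by positivity),
      ← Real.rpow_mul_natCast (by positivity)]
    congr 1
    rw [Nat.cast_ofNat, div_mul_cancel₀ _ two_ne_zero, Real.rpow_natCast]
  rw [ENNReal.ofReal_mul (by positivity), mul_pow, hL, show (4 : ℝ≥0∞) = 2 * 2 by norm_num, mul_pow]
  ring

/-- Moment bound for U-statistics with nonnegative kernels, by induction on the order from
`eLpNorm_usum_le_add`. -/
theorem exists_eLpNorm_usum_le (r : ℕ) : ∃ C : NNReal, ∀ {S : Type*} [MeasurableSpace S]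
    (P : Measure S) [IsProbabilityMeasure P] (n p : ℕ) (_ : 1 ≤ p) (m : ℝ) (_ : 1 ≤ m)
    (f : (Fin r → S) → Fin p → ℝ) (_ : Measurable f)
    (_ : ∀ (σ : Equiv.Perm (Fin r)) (x : Fin r → S), f (fun i => x (σ i)) = f x)
    (_ : ∀ x, 0 ≤ f x) (_ : MemLp f (ENNReal.ofReal m) (Measure.pi fun _ => P)),
    eLpNorm (usum f) (ENNReal.ofReal m) (Measure.pi fun _ : Fin n => P) ≤
      C * ∑ s ∈ Finset.range (r + 1), (n : ℝ≥0∞) ^ (r - s) *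
        (ENNReal.ofReal (m + Real.log p) ^ s *
          eLpNorm (tupleValues (vecMean P s f)) (ENNReal.ofReal m)
            (Measure.pi fun _ : Fin n => P)) := by
  induction r using Nat.strong_induction_on with
  | _ r ih =>
    choose! C hC using ih
    refine ⟨(Real.exp 1 * 6 ^ ((r : ℝ) / 2)).toNNReal ^ 2 * 4 ^ r +
      2 * ∑ j ∈ Finset.range r, C (r - (j + 1)), ?_⟩
    intro S _ P _ n p hp m hm f hfm hs hf0 hf
    have hm' : 1 ≤ ENNReal.ofReal m := by simpa using hm
    have hint := hf.integrable hm'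
    set T : ℕ → ℝ≥0∞ := fun s => (n : ℝ≥0∞) ^ (r - s) *
      (ENNReal.ofReal (m + Real.log p) ^ s * eLpNorm (tupleValues (vecMean P s f))
        (ENNReal.ofReal m) (Measure.pi fun _ : Fin n => P)) with hT
    have hstep := eLpNorm_usum_le_add (n := n) hp hm hfm hs hf0 hf
    have h1 : ENNReal.ofReal (m + Real.log p) ^ r * eLpNorm (tupleValues f) (ENNReal.ofReal m)
        (Measure.pi fun _ : Fin n => P) ≤ ∑ s ∈ Finset.range (r + 1), T s := by
      have : T r ≤ ∑ s ∈ Finset.range (r + 1), T s :=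
        Finset.single_le_sum (f := T) (fun _ _ => zero_le) (Finset.self_mem_range_succ r)
      simpa only [hT, Nat.sub_self, pow_zero, one_mul, vecMean_self] using this
    have h2 : ∀ j ∈ Finset.range r, (n : ℝ≥0∞) ^ (j + 1) *
        eLpNorm (usum (vecMean P (r - (j + 1)) f)) (ENNReal.ofReal m)
          (Measure.pi fun _ : Fin n => P) ≤
        C (r - (j + 1)) * ∑ s ∈ Finset.range (r + 1), T s := by
      intro j hj
      have hjr := Finset.mem_range.1 hj
      obtain ⟨s, hs'⟩ : ∃ s, s = r - (j + 1) := ⟨_, rfl⟩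
      rw [← hs']
      have hsr : s ≤ r := by omega
      have h3 := hC s (by omega) P n p hp m hm (vecMean P s f) (measurable_vecMean hfm)
        (vecMean_perm hsr hs) (vecMean_nonneg hf0) (memLp_vecMean hsr hfm hm hf)
      calc _ ≤ (n : ℝ≥0∞) ^ (j + 1) * _ := mul_le_mul_right h3 _
        _ = C s * ∑ u ∈ Finset.range (s + 1), T u := by
          rw [mul_left_comm, Finset.mul_sum]
          congr 1
          refine Finset.sum_congr rfl fun u hu => ?_
          have hus : u ≤ s := Nat.lt_succ_iff.1 (Finset.mem_range.1 hu)
          rw [eLpNorm_congr_ae (tupleValues_congr_ae (vecMean_vecMean hus hsr hfm hint)),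
            ← mul_assoc, ← pow_add, show j + 1 + (s - u) = r - u by omega]
        _ ≤ C s * ∑ u ∈ Finset.range (r + 1), T u := by
          gcongr
    refine hstep.trans ?_
    push_cast
    rw [add_mul]
    refine add_le_add (mul_le_mul_right h1 _) ?_
    rw [mul_assoc, Finset.sum_mul]
    exact mul_le_mul_right (Finset.sum_le_sum h2) _

end Nonneg

/-! ### The bound for degenerate kernels -/

section Transfer

variable {Ω S : Type*} {n r p : ℕ}

theorem pi_norm_eq_iSup_norm {ι E : Type*} [Fintype ι] [NormedAddCommGroup E] (v : ι → E) :
    ‖v‖ = ⨆ j, ‖v j‖ := by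
  refine le_antisymm ?_ (Real.iSup_le (norm_le_pi_norm v) (norm_nonneg v))
  rw [pi_norm_le_iff_of_nonneg (Real.iSup_nonneg fun j => norm_nonneg _)]
  exact le_ciSup (Set.finite_range fun j => ‖v j‖).bddAbove

theorem iSup_abs_J_eq (X : Fin n → Ω → S) (ψ : Fin p → (Fin r → S) → ℝ) (ω : Ω) :
    ⨆ j, |J X (ψ j) ω| = ‖usum (fun y j => ψ j y) (fun i => X i ω)‖ := by
  rw [pi_norm_eq_iSup_norm, usum_eq_sum_orderEmb]
  simp [J]

theorem norm_tupleValues_le_iSup_M (X : Fin n → Ω → S) (g : (Fin r → S) → Fin p → ℝ) (ω : Ω) :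
    ‖tupleValues g (fun i => X i ω)‖ ≤ ⨆ j, M X (fun y => g y j) ω := by
  have hM : ∀ j, M X (fun y => g y j) ω = ‖fun i : Fin r ↪ Fin n => g (fun k => X (i k) ω) j‖ :=
    fun j => by rw [pi_norm_eq_iSup_norm]; rfl
  have h0 : 0 ≤ ⨆ j, M X (fun y => g y j) ω :=
    Real.iSup_nonneg fun j => by rw [hM]; exact norm_nonneg _
  rw [pi_norm_le_iff_of_nonneg h0]
  intro i
  rw [pi_norm_le_iff_of_nonneg h0]
  intro j
  refine le_trans ?_ (le_ciSup (Set.finite_range fun j => M X (fun y => g y j) ω).bddAbove j)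
  rw [hM]
  exact norm_le_pi_norm (fun i : Fin r ↪ Fin n => g (fun k => X (i k) ω) j) i

end Transfer

/-- The moment bound for degenerate U-statistics on the canonical sample space `S^n`. -/
theorem exists_eLpNorm_usum_le_of_degenerate (r : ℕ) : ∃ C : ℝ, 0 < C ∧
    ∀ {S : Type*} [MeasurableSpace S] (P : Measure S) [IsProbabilityMeasure P] (n p : ℕ)
      (_ : 1 ≤ p) (q : ℝ) (_ : 1 ≤ q) (f : (Fin r → S) → Fin p → ℝ) (_ : Measurable f)
      (_ : ∀ (σ : Equiv.Perm (Fin r)) (x : Fin r → S), f (fun i => x (σ i)) = f x)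
      (_ : MemLp f (ENNReal.ofReal (max q 2)) (Measure.pi fun _ => P))
      (_ : ∀ j, IsDegenerate P fun x => f x j),
      eLpNorm (usum f) (ENNReal.ofReal q) (Measure.pi fun _ : Fin n => P) ≤
        ENNReal.ofReal C * ⨆ s : Fin (r + 1),
          ENNReal.ofReal ((n : ℝ) ^ (((r : ℝ) - (s : ℕ)) / 2) *
              (q + Real.log p) ^ (((r : ℝ) + (s : ℕ)) / 2)) *
            (eLpNorm (tupleValues (vecMean P (s : ℕ) fun y => f y ^ 2))
              (ENNReal.ofReal (max 1 (q / 2))) (Measure.pi fun _ : Fin n => P)) ^ (1 / 2 : ℝ) := by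
  obtain ⟨C₀, hC₀⟩ := exists_eLpNorm_usum_le r
  set c : ℝ := Real.exp 1 * 6 ^ ((r : ℝ) / 2) * 2 ^ ((r : ℝ) / 2) with hc
  have hc0 : 0 < c := by positivity
  -- `C₀ + 1` instead of `C₀`, which may vanish, keeps the final constant positive
  set B : ℝ := 2 ^ r * ((C₀ + 1) * (r + 1)) with hB
  have hB0 : 0 < B := by positivity
  refine ⟨c * B ^ (1 / 2 : ℝ), by positivity, ?_⟩
  intro S _ P _ n p hp q hq f hfm hs hf hdeg
  have hlog : 0 ≤ Real.log p := Real.log_natCast_nonneg p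
  set L : ℝ := q + Real.log p with hL
  have hL1 : 1 ≤ L := by linarith
  set m : ℝ := max 1 (q / 2) with hm
  have hm1 : 1 ≤ m := le_max_left _ _
  have hmq : m ≤ q := max_le hq (by linarith)
  have hqm : max q 2 = 2 * m := by
    rw [hm, mul_max_of_nonneg _ _ zero_le_two, max_comm]; congr 1 <;> ring
  -- the exponent `q` is raised to `max q 2 = 2 m`, so that the square function has exponent `m ≥ 1`
  rw [hqm] at hf
  set g : (Fin r → S) → Fin p → ℝ := fun y => f y ^ 2 with hg
  have hgm : Measurable g := hfm.pow_const 2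
  have hgL : MemLp g (ENNReal.ofReal m) (Measure.pi fun _ => P) := by
    refine ⟨hgm.aestronglyMeasurable, lt_of_le_of_lt ?_
      (ENNReal.rpow_lt_top_of_nonneg zero_le_two hf.2.ne)⟩
    rw [eLpNorm_ofReal _ _ hm1, eLpNorm_ofReal _ _ (by linarith), ← ENNReal.rpow_mul,
      show 1 / (2 * m) * 2 = 1 / m by field_simp]
    refine ENNReal.rpow_le_rpow (lintegral_mono fun y => ?_) (by positivity)
    rw [ENNReal.rpow_mul, ENNReal.rpow_two]
    have hy : ‖f y ^ 2‖ₑ ≤ ‖f y‖ₑ ^ 2 := by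
      rw [sq, sq, enorm_eq_nnnorm, enorm_eq_nnnorm, ← ENNReal.coe_mul]
      exact ENNReal.coe_le_coe.2 (nnnorm_mul_le _ _)
    exact ENNReal.rpow_le_rpow hy (by linarith)
  set V := eLpNorm (usum g) (ENNReal.ofReal m) (Measure.pi fun _ : Fin n => P) with hV
  set U : ℕ → ℝ≥0∞ := fun s => eLpNorm (tupleValues (vecMean P s g)) (ENNReal.ofReal m)
    (Measure.pi fun _ : Fin n => P) with hU
  set T := ⨆ s : Fin (r + 1), ENNReal.ofReal ((n : ℝ) ^ (((r : ℝ) - (s : ℕ)) / 2) *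
    L ^ (((r : ℝ) + (s : ℕ)) / 2)) * U s ^ (1 / 2 : ℝ) with hT
  have hterm : ∀ s ∈ Finset.range (r + 1), ENNReal.ofReal L ^ r *
      ((n : ℝ≥0∞) ^ (r - s) * (ENNReal.ofReal (m + Real.log p) ^ s * U s)) ≤ T ^ 2 := by
    intro s hs'
    have hsr : s ≤ r := Nat.lt_succ_iff.1 (Finset.mem_range.1 hs')
    have h1 : ENNReal.ofReal ((n : ℝ) ^ (((r : ℝ) - s) / 2) * L ^ (((r : ℝ) + s) / 2)) *
        U s ^ (1 / 2 : ℝ) ≤ T :=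
      le_iSup (fun s : Fin (r + 1) => ENNReal.ofReal ((n : ℝ) ^ (((r : ℝ) - (s : ℕ)) / 2) *
        L ^ (((r : ℝ) + (s : ℕ)) / 2)) * U s ^ (1 / 2 : ℝ)) ⟨s, Nat.lt_succ_iff.2 hsr⟩
    refine le_trans ?_ (pow_le_pow_left' h1 2)
    have e1 : ((n : ℝ) ^ (((r : ℝ) - s) / 2)) ^ 2 = (n : ℝ) ^ (r - s) := by
      rw [← Real.rpow_mul_natCast (Nat.cast_nonneg n), Nat.cast_ofNat,
        div_mul_cancel₀ _ two_ne_zero, ← Nat.cast_sub hsr, Real.rpow_natCast]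
    have e2 : (L ^ (((r : ℝ) + s) / 2)) ^ 2 = L ^ (r + s) := by
      rw [← Real.rpow_mul_natCast (by positivity), Nat.cast_ofNat,
        div_mul_cancel₀ _ two_ne_zero, ← Nat.cast_add, Real.rpow_natCast]
    have e3 : (U s ^ (1 / 2 : ℝ)) ^ 2 = U s := by
      rw [← ENNReal.rpow_natCast, ← ENNReal.rpow_mul]; norm_num
    rw [mul_pow, e3, ← ENNReal.ofReal_pow
      (show 0 ≤ (n : ℝ) ^ (((r : ℝ) - s) / 2) * L ^ (((r : ℝ) + s) / 2) by positivity), mul_pow, e1, e2,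
      ENNReal.ofReal_mul (by positivity), ENNReal.ofReal_pow (Nat.cast_nonneg n),
      ENNReal.ofReal_natCast, ENNReal.ofReal_pow (by positivity), pow_add]
    calc _ ≤ ENNReal.ofReal L ^ r * ((n : ℝ≥0∞) ^ (r - s) * (ENNReal.ofReal L ^ s * U s)) := by
          gcongr
          linarith
      _ = _ := by ring
  have hVT : ENNReal.ofReal L ^ r * (2 ^ r * V) ≤ ENNReal.ofReal B * T ^ 2 := by
    calc ENNReal.ofReal L ^ r * (2 ^ r * V)
        ≤ ENNReal.ofReal L ^ r * (2 ^ r * (C₀ * ∑ s ∈ Finset.range (r + 1), (n : ℝ≥0∞) ^ (r - s) *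
            (ENNReal.ofReal (m + Real.log p) ^ s * U s))) := by
          gcongr
          exact hC₀ P n p hp m hm1 g hgm (fun σ x => by simp only [hg, hs])
            (fun x j => sq_nonneg (f x j)) hgL
      _ = 2 ^ r * (C₀ * ∑ s ∈ Finset.range (r + 1), ENNReal.ofReal L ^ r *
            ((n : ℝ≥0∞) ^ (r - s) * (ENNReal.ofReal (m + Real.log p) ^ s * U s))) := by
          rw [← Finset.mul_sum]; ring
      _ ≤ 2 ^ r * (C₀ * ∑ s ∈ Finset.range (r + 1), T ^ 2) := by
          gcongr with s hs'
          exact hterm s hs'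
      _ = 2 ^ r * (C₀ * (r + 1)) * T ^ 2 := by
          rw [Finset.sum_const, Finset.card_range, nsmul_eq_mul]; push_cast; ring
      _ ≤ ENNReal.ofReal B * T ^ 2 := by
          gcongr
          rw [hB, ENNReal.ofReal_mul (by positivity), ENNReal.ofReal_mul (by positivity),
            ENNReal.ofReal_pow zero_le_two, ENNReal.ofReal_ofNat,
            ENNReal.ofReal_add (by positivity) zero_le_one,
            ENNReal.ofReal_add (by positivity) zero_le_one, ENNReal.ofReal_natCast,
            ENNReal.ofReal_coe_nnreal, ENNReal.ofReal_one]
          gcongr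
          exact le_self_add
  have hA := eLpNorm_usum_le_of_degenerate (n := n) P hp (q := 2 * m) (by linarith) hfm hs
    (hf.integrable (by rw [ENNReal.one_le_ofReal]; linarith)) hdeg
  rw [mul_div_cancel_left₀ m two_ne_zero] at hA
  have hmono : ENNReal.ofReal (Real.exp 1 * 6 ^ ((r : ℝ) / 2) *
      (2 * m + Real.log p) ^ ((r : ℝ) / 2)) ≤
      ENNReal.ofReal c * (ENNReal.ofReal L ^ r) ^ (1 / 2 : ℝ) := by
    have e : (ENNReal.ofReal L ^ r) ^ (1 / 2 : ℝ) = ENNReal.ofReal (L ^ ((r : ℝ) / 2)) := by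
      rw [← ENNReal.rpow_natCast, ← ENNReal.rpow_mul,
        ENNReal.ofReal_rpow_of_nonneg (by positivity) (by positivity)]
      congr 2
      ring
    rw [e, ← ENNReal.ofReal_mul hc0.le]
    refine ENNReal.ofReal_le_ofReal ?_
    rw [hc, mul_assoc _ ((2 : ℝ) ^ _), ← Real.mul_rpow zero_le_two (by positivity)]
    gcongr
    linarith
  calc eLpNorm (usum f) (ENNReal.ofReal q) (Measure.pi fun _ : Fin n => P)
      ≤ eLpNorm (usum f) (ENNReal.ofReal (2 * m)) (Measure.pi fun _ : Fin n => P) :=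
        eLpNorm_le_eLpNorm_of_exponent_le
          (ENNReal.ofReal_le_ofReal (hqm ▸ le_max_left q 2))
          (measurable_usum hfm).aestronglyMeasurable
    _ ≤ _ := hA
    _ ≤ ENNReal.ofReal c * (ENNReal.ofReal L ^ r) ^ (1 / 2 : ℝ) * (2 ^ r * V) ^ (1 / 2 : ℝ) :=
        mul_le_mul_left hmono _
    _ = ENNReal.ofReal c * (ENNReal.ofReal L ^ r * (2 ^ r * V)) ^ (1 / 2 : ℝ) := by
        rw [mul_assoc, ← ENNReal.mul_rpow_of_nonneg _ _ (by positivity)]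
    _ ≤ ENNReal.ofReal c * (ENNReal.ofReal B * T ^ 2) ^ (1 / 2 : ℝ) := by gcongr
    _ = ENNReal.ofReal (c * B ^ (1 / 2 : ℝ)) * T := by
        rw [ENNReal.mul_rpow_of_nonneg _ _ (by positivity), ENNReal.ofReal_mul hc0.le,
          ENNReal.ofReal_rpow_of_nonneg hB0.le (by positivity), ← ENNReal.rpow_natCast T,
          ← ENNReal.rpow_mul, mul_assoc]
        norm_num

end UStat

theorem theorem4 (r : ℕ) (hr : 1 ≤ r) :
    ∃ C : ℝ, 0 < C ∧
      ∀ {Ω : Type*} [MeasurableSpace Ω] (μ : Measure Ω) [IsProbabilityMeasure μ]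
        {S : Type*} [MeasurableSpace S] (P : Measure S) [IsProbabilityMeasure P]
        (n p : ℕ) (_hp : 1 ≤ p) (q : ℝ) (_hq : 1 ≤ q)
        (X : Fin n → Ω → S) (_hX : ∀ i, Measurable (X i)) (_hindep : iIndepFun X μ)
        (_hlaw : ∀ i, μ.map (X i) = P)
        (ψ : Fin p → (Fin r → S) → ℝ)
        (_hsymm : ∀ j, UStat.IsSymmetricKernel (ψ j))
        (_hLp : ∀ j, MemLp (ψ j) (ENNReal.ofReal (max q 2)) (Measure.pi fun _ : Fin r => P))
        (_hdeg : ∀ j, UStat.IsDegenerate P (ψ j)),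
        eLpNorm (fun ω => ⨆ j : Fin p, |UStat.J X (ψ j) ω|) (ENNReal.ofReal q) μ ≤
          ENNReal.ofReal C *
            ⨆ s : Fin (r + 1),
              ENNReal.ofReal ((n : ℝ) ^ (((r : ℝ) - (s : ℕ)) / 2) *
                  (q + Real.log p) ^ (((r : ℝ) + (s : ℕ)) / 2)) *
                (eLpNorm
                  (fun ω => ⨆ j : Fin p,
                    UStat.M X (UStat.partialMean P (s : ℕ) (fun y => (ψ j y) ^ 2)) ω)
                  (ENNReal.ofReal (max 1 (q / 2))) μ) ^ (1 / 2 : ℝ) := by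
  obtain ⟨C, hC, h⟩ := UStat.exists_eLpNorm_usum_le_of_degenerate r
  refine ⟨C, hC, ?_⟩
  intro Ω _ μ _ S _ P _ n p hp q hq X hX hindep hlaw ψ hsymm hLp hdeg
  set f : (Fin r → S) → Fin p → ℝ := fun y j => ψ j y
  have hfm : Measurable f := measurable_pi_lambda _ fun j => (hsymm j).1
  have hmp : MeasurePreserving (fun ω i => X i ω) μ (Measure.pi fun _ : Fin n => P) := by
    refine ⟨measurable_pi_lambda _ hX, ?_⟩
    rw [(iIndepFun_iff_map_fun_eq_pi_map fun i => (hX i).aemeasurable).1 hindep]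
    simp only [hlaw]
  have hmain := h P n p hp q hq f hfm (fun σ x => funext fun j => (hsymm j).2 σ x)
    (memLp_pi_iff.2 hLp) hdeg
  calc eLpNorm (fun ω => ⨆ j : Fin p, |UStat.J X (ψ j) ω|) (ENNReal.ofReal q) μ
      = eLpNorm (UStat.usum f) (ENNReal.ofReal q) (Measure.pi fun _ : Fin n => P) := by
        simp only [UStat.iSup_abs_J_eq]
        rw [← eLpNorm_comp_measurePreserving (UStat.measurable_usum hfm).aestronglyMeasurable hmp]
        exact eLpNorm_norm _
    _ ≤ _ := hmain
    _ ≤ _ := by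
        refine mul_le_mul_right (iSup_mono fun s => mul_le_mul_right
          (ENNReal.rpow_le_rpow ?_ (by positivity)) _) _
        rw [← eLpNorm_comp_measurePreserving (UStat.measurable_tupleValues
          (UStat.measurable_vecMean (hfm.pow_const 2))).aestronglyMeasurable hmp]
        exact eLpNorm_mono_real fun ω => UStat.norm_tupleValues_le_iSup_M X _ ω
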